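/- Let $\mathbb{B}^2=\{z\in\mathbb{C}^2 : |z|^2=|z_1|^2+|z_2|^2<1\}$ and let $\mathrm{SU}(2,1)$ be the group of matrices of determinant $1$ preserving the Hermitian form $\langle u,v\rangle=u_1\overline{v_1}+u_2\overline{v_2}-u_3\overline{v_3}$ on $\mathbb{C}^3$, acting on $\mathbb{B}^2$ by fractional linear transformations. Let $\Gamma\subset\mathrm{SU}(2,1)$ be a discrete, torsion-free, cocompact subgroup, and let $X_\Gamma=\Gamma\backslash\mathbb{B}^2$ be the associated compact Picard surface. Equip $\mathbb{B}^2$ and $X_\Gamma$ with the hyperbolic metric $-\tfrac{i}{2}\partial\overline\partial\log(1-|z|^2)$, and with its volume form $\mu^{\mathrm{vol}}_{\mathrm{hyp}}(z)=(i/2)^2(1-|z|^2)^{-3}\,dz_1\wedge d\overline{z_1}\wedge dz_2\wedge d\overline{z_2}$. Let the hyperbolic distance on $\mathbb{B}^2$ be normalized by $$\cosh^2\big(d_{\mathrm{hyp}}(z,w)/2\big)=\frac{|\langle\tilde z,\tilde w\rangle|^2}{\langle\tilde z,\tilde z\rangle\langle\tilde w,\tilde w\rangle},\qquad \tilde z=(z_1,z_2,1),\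 \tilde w=(w_1,w_2,1),$$ and for $z,w\in X_\Gamma$ let $d_{\mathrm{hyp}}(z,w)$ be the geodesic distance on $X_\Gamma$, that is, the least distance between lifts of $z$ and $w$ to $\mathbb{B}^2$. Let $\Lambda=\Omega^2_{X_\Gamma}$ be the line bundle of holomorphic $(2,0)$-forms. For $k\ge 1$ the hyperbolic metric induces a point-wise metric $|\cdot|_{\mathrm{hyp}}$ on $\Lambda^{\otimes k}$, given on the ball by $|f(z)(dz_1\wedge dz_2)^{\otimes k}|_{\mathrm{hyp}}^2=(1-|z|^2)^{3k}|f(z)|^2$, and, by integration against $\mu^{\mathrm{vol}}_{\mathrm{hyp}}$, an $L^2$ inner product on $H^0(X_\Gamma,\Lambda^{\otimes k})$. Let $\omega_1,\dots,\omega_{d_k}$ be an orthonormal basis of $H^0(X_\Gamma,\Lambda^{\otimes k})$, and let $\mathcal{B}^k_\Lambda(z,w)=\sum_{j=1}^{d_k}\omega_j(z)\overline{\omega_j(w)}$ be the Bergman kernel. If $\omega_j=f_j\,(dz_1\wedge dz_2)^{\otimes k}$ on the ball, its point-wise norm is $|\mathcal{B}^k_\Lambda(z,w)|_{\mathrm{hyp}}=(1-|z|^2)^{3k/2}(1-|w|^2)^{3k/2}\big|\sum_j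 f_j(z)\overline{f_j(w)}\big|$. Then there is a constant $C$, depending only on $X_\Gamma$, such that for all $k\ge 3$ and all $z,w\in X_\Gamma$, $$\big|\mathcal{B}^k_\Lambda(z,w)\big|_{\mathrm{hyp}}\le C\,\frac{k^2}{\cosh^{3k-8}\big(d_{\mathrm{hyp}}(z,w)/2\big)}.$$ -/

import Mathlib

noncomputable section

/-! # The complex ball, the group SU(2,1), and its action -/

/-- Matrix of the standard Hermitian form of signature (2,1) on `ℂ³`. -/
def formH : Matrix (Fin 3) (Fin 3) ℂ := Matrix.diagonal ![1, 1, -1]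

/-- The group `SU((2,1), ℂ)`, as a subgroup of `SL(3, ℂ)`. -/
def SU21 : Subgroup (Matrix.SpecialLinearGroup (Fin 3) ℂ) where
  carrier := {A | (A : Matrix (Fin 3) (Fin 3) ℂ).conjTranspose * formH * A = formH}
  one_mem' := by simp
  mul_mem' := by
    intro A B hA hB
    simp only [Set.mem_ofPred_eq, Matrix.SpecialLinearGroup.coe_mul,
      Matrix.conjTranspose_mul] at hA hB ⊢
    calc (B : Matrix (Fin 3) (Fin 3) ℂ).conjTranspose *
          (A : Matrix (Fin 3) (Fin 3) ℂ).conjTranspose * formH * (↑A * ↑B)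
        = (B : Matrix (Fin 3) (Fin 3) ℂ).conjTranspose *
          ((A : Matrix (Fin 3) (Fin 3) ℂ).conjTranspose * formH * ↑A) * ↑B := by
          simp only [Matrix.mul_assoc]
      _ = formH := by rw [hA, hB]
  inv_mem' := by
    intro A hA
    simp only [Set.mem_ofPred_eq] at hA ⊢
    have h1 : (A : Matrix (Fin 3) (Fin 3) ℂ) *
        ((A⁻¹ : Matrix.SpecialLinearGroup (Fin 3) ℂ) : Matrix (Fin 3) (Fin 3) ℂ) = 1 := by
      rw [← Matrix.SpecialLinearGroup.coe_mul, mul_inv_cancel, Matrix.SpecialLinearGroup.coe_one]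
    have h2 : ((A⁻¹ : Matrix.SpecialLinearGroup (Fin 3) ℂ) :
        Matrix (Fin 3) (Fin 3) ℂ).conjTranspose *
        (A : Matrix (Fin 3) (Fin 3) ℂ).conjTranspose = 1 := by
      rw [← Matrix.conjTranspose_mul, h1, Matrix.conjTranspose_one]
    calc ((A⁻¹ : Matrix.SpecialLinearGroup (Fin 3) ℂ) :
          Matrix (Fin 3) (Fin 3) ℂ).conjTranspose * formH *
          ((A⁻¹ : Matrix.SpecialLinearGroup (Fin 3) ℂ) : Matrix (Fin 3) (Fin 3) ℂ)
        = ((A⁻¹ : Matrix.SpecialLinearGroup (Fin 3) ℂ) :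
          Matrix (Fin 3) (Fin 3) ℂ).conjTranspose *
          ((A : Matrix (Fin 3) (Fin 3) ℂ).conjTranspose * formH * ↑A) *
          ((A⁻¹ : Matrix.SpecialLinearGroup (Fin 3) ℂ) : Matrix (Fin 3) (Fin 3) ℂ) := by
          rw [hA]
      _ = (((A⁻¹ : Matrix.SpecialLinearGroup (Fin 3) ℂ) :
          Matrix (Fin 3) (Fin 3) ℂ).conjTranspose *
          (A : Matrix (Fin 3) (Fin 3) ℂ).conjTranspose) * formH * (↑A *
          ((A⁻¹ : Matrix.SpecialLinearGroup (Fin 3) ℂ) : Matrix (Fin 3) (Fin 3) ℂ)) := by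
          simp only [Matrix.mul_assoc]
      _ = formH := by rw [h1, h2]; simp

/-- The squared Euclidean norm `|z|² = |z₁|² + |z₂|²` on `ℂ²`. -/
def normSq2 (z : Fin 2 → ℂ) : ℝ := ‖z 0‖ ^ 2 + ‖z 1‖ ^ 2

/-- The open unit ball `𝔹²` of `ℂ²`, as a set. -/
def ballSet : Set (Fin 2 → ℂ) := {z | normSq2 z < 1}

/-- The open unit ball `𝔹²` of `ℂ²`, as a space. -/
abbrev Ball2 : Type := {z : Fin 2 → ℂ // z ∈ ballSet}

/-- The lift `(z₁, z₂, 1)` of a point of `ℂ²` to `ℂ³`. -/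
def lift3 (z : Fin 2 → ℂ) : Fin 3 → ℂ := ![z 0, z 1, 1]

/-- The Hermitian form `⟨u, v⟩ = v* H u` of signature (2,1) on `ℂ³`. -/
def herm (u v : Fin 3 → ℂ) : ℂ := star v ⬝ᵥ (formH.mulVec u)

/-- The fractional linear map `z ↦ (A z + B) / (C z + D)` of the matrix with blocks
`A, B, C, D` (a total function, meaningful where `C z + D ≠ 0`). -/
def fracLin (γ : Matrix (Fin 3) (Fin 3) ℂ) (z : Fin 2 → ℂ) : Fin 2 → ℂ :=
  fun i => γ.mulVec (lift3 z) i.castSucc / γ.mulVec (lift3 z) 2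

theorem herm_apply (u v : Fin 3 → ℂ) :
    herm u v = u 0 * star (v 0) + u 1 * star (v 1) - u 2 * star (v 2) := by
  simp [herm, formH, Matrix.mulVec_diagonal, dotProduct, Fin.sum_univ_three]
  ring

theorem herm_self (u : Fin 3 → ℂ) :
    herm u u = ((‖u 0‖ ^ 2 + ‖u 1‖ ^ 2 - ‖u 2‖ ^ 2 : ℝ) : ℂ) := by
  rw [herm_apply]
  simp only [Complex.star_def, Complex.mul_conj, Complex.normSq_eq_norm_sq]
  push_cast
  ring

theorem herm_mulVec {γ : Matrix.SpecialLinearGroup (Fin 3) ℂ} (hγ : γ ∈ SU21)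
    (u v : Fin 3 → ℂ) :
    herm ((γ : Matrix (Fin 3) (Fin 3) ℂ).mulVec u)
      ((γ : Matrix (Fin 3) (Fin 3) ℂ).mulVec v) = herm u v := by
  have h : (γ : Matrix (Fin 3) (Fin 3) ℂ).conjTranspose * formH * γ = formH := hγ
  unfold herm
  rw [Matrix.star_mulVec, ← Matrix.dotProduct_mulVec, Matrix.mulVec_mulVec, Matrix.mulVec_mulVec, h]

theorem norm_mulVec_lift3 {γ : Matrix.SpecialLinearGroup (Fin 3) ℂ} (hγ : γ ∈ SU21)
    (z : Fin 2 → ℂ) :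
    ‖(γ : Matrix (Fin 3) (Fin 3) ℂ).mulVec (lift3 z) 0‖ ^ 2 +
      ‖(γ : Matrix (Fin 3) (Fin 3) ℂ).mulVec (lift3 z) 1‖ ^ 2 -
      ‖(γ : Matrix (Fin 3) (Fin 3) ℂ).mulVec (lift3 z) 2‖ ^ 2 = normSq2 z - 1 := by
  have h := herm_mulVec hγ (lift3 z) (lift3 z)
  rw [herm_self, herm_self] at h
  have h' := Complex.ofReal_injective h
  simpa [lift3, normSq2] using h'

theorem denom_ne_zero {γ : Matrix.SpecialLinearGroup (Fin 3) ℂ} (hγ : γ ∈ SU21)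
    {z : Fin 2 → ℂ} (hz : z ∈ ballSet) :
    (γ : Matrix (Fin 3) (Fin 3) ℂ).mulVec (lift3 z) 2 ≠ 0 := by
  intro h0
  have h := norm_mulVec_lift3 hγ z
  have hz' : normSq2 z < 1 := hz
  rw [h0, norm_zero] at h
  nlinarith [sq_nonneg ‖(γ : Matrix (Fin 3) (Fin 3) ℂ).mulVec (lift3 z) 0‖,
    sq_nonneg ‖(γ : Matrix (Fin 3) (Fin 3) ℂ).mulVec (lift3 z) 1‖]

theorem fracLin_mem {γ : Matrix.SpecialLinearGroup (Fin 3) ℂ} (hγ : γ ∈ SU21)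
    {z : Fin 2 → ℂ} (hz : z ∈ ballSet) :
    fracLin (γ : Matrix (Fin 3) (Fin 3) ℂ) z ∈ ballSet := by
  have hd := denom_ne_zero hγ hz
  have hpos : 0 < ‖(γ : Matrix (Fin 3) (Fin 3) ℂ).mulVec (lift3 z) 2‖ := norm_pos_iff.mpr hd
  have h := norm_mulVec_lift3 hγ z
  have hz' : normSq2 z < 1 := hz
  change ‖_ / _‖ ^ 2 + ‖_ / _‖ ^ 2 < (1 : ℝ)
  rw [norm_div, norm_div, div_pow, div_pow, ← add_div, div_lt_one (by positivity)]
  change ‖(γ : Matrix (Fin 3) (Fin 3) ℂ).mulVec (lift3 z) 0‖ ^ 2 +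
      ‖(γ : Matrix (Fin 3) (Fin 3) ℂ).mulVec (lift3 z) 1‖ ^ 2 < _
  linarith

theorem smul_lift3_fracLin {γ : Matrix (Fin 3) (Fin 3) ℂ} {z : Fin 2 → ℂ}
    (hd : γ.mulVec (lift3 z) 2 ≠ 0) :
    γ.mulVec (lift3 z) 2 • lift3 (fracLin γ z) = γ.mulVec (lift3 z) := by
  funext i
  fin_cases i
  · exact mul_div_cancel₀ _ hd
  · exact mul_div_cancel₀ _ hd
  · exact mul_one _

/-- The action of `SU((2,1), ℂ)` on the ball by fractional linear transformations. -/
instance : MulAction SU21 Ball2 where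
  smul γ z := ⟨fracLin (γ : Matrix.SpecialLinearGroup (Fin 3) ℂ) z.1, fracLin_mem γ.2 z.2⟩
  one_smul z := by
    apply Subtype.ext
    funext i
    change fracLin _ _ i = _
    fin_cases i <;> simp [fracLin, lift3]
  mul_smul γ δ z := by
    apply Subtype.ext
    change fracLin ((γ * δ : SU21) : Matrix.SpecialLinearGroup (Fin 3) ℂ) z.1 =
      fracLin (γ : Matrix.SpecialLinearGroup (Fin 3) ℂ)
        (fracLin (δ : Matrix.SpecialLinearGroup (Fin 3) ℂ) z.1)
    have hd := denom_ne_zero δ.2 z.2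
    have h := smul_lift3_fracLin hd
    have h2 : ((γ * δ : SU21) : Matrix.SpecialLinearGroup (Fin 3) ℂ).1.mulVec (lift3 z.1) =
        (δ : Matrix.SpecialLinearGroup (Fin 3) ℂ).1.mulVec (lift3 z.1) 2 •
        (γ : Matrix.SpecialLinearGroup (Fin 3) ℂ).1.mulVec
          (lift3 (fracLin (δ : Matrix.SpecialLinearGroup (Fin 3) ℂ) z.1)) := by
      rw [← Matrix.mulVec_smul, h, Matrix.mulVec_mulVec]
      rfl
    funext i
    unfold fracLin at h2 ⊢
    rw [h2]
    simp only [Pi.smul_apply, smul_eq_mul]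
    rw [mul_div_mul_left _ _ hd]

/-! # The hyperbolic metric, volume and distance on the ball -/

/-- The Hermitian matrix `g_{ij} = -∂_i ∂̄_j log (1 - |z|²)` of the hyperbolic metric
`-(i/2) ∂∂̄ log (1 - |z|²) = (i/2) ∑ g_{ij} dz_i ∧ dz̄_j` at `z`. -/
def hypMetric (z : Ball2) : Matrix (Fin 2) (Fin 2) ℂ :=
  Matrix.of fun i j =>
    (if i = j then 1 / (1 - (normSq2 z.1 : ℂ)) else 0) +
      star (z.1 i) * z.1 j / (1 - (normSq2 z.1 : ℂ)) ^ 2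

theorem one_sub_normSq2_pos (z : Ball2) : 0 < 1 - normSq2 z.1 := sub_pos.mpr z.2

theorem hypMetric_det (z : Ball2) :
    (hypMetric z).det = ((1 / (1 - normSq2 z.1) ^ 3 : ℝ) : ℂ) := by
  have h : (1 - (normSq2 z.1 : ℂ)) ≠ 0 := by
    exact_mod_cast (one_sub_normSq2_pos z).ne'
  have hs : (normSq2 z.1 : ℂ) = z.1 0 * star (z.1 0) + z.1 1 * star (z.1 1) := by
    simp [normSq2, Complex.mul_conj, Complex.normSq_eq_norm_sq]
  rw [Matrix.det_fin_two]
  simp only [hypMetric, Matrix.of_apply, if_true, Fin.zero_eq_one_iff, Fin.one_eq_zero_iff,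
    OfNat.ofNat_ne_one, if_false, zero_add]
  push_cast
  field_simp
  rw [hs]
  ring

/-- The hyperbolic volume measure `(1 - |z|²)⁻³ · (Lebesgue measure)` on the ball. -/
def hypVol : MeasureTheory.Measure Ball2 :=
  (MeasureTheory.Measure.comap Subtype.val MeasureTheory.volume).withDensity
    fun z => ENNReal.ofReal (1 / (1 - normSq2 z.1) ^ 3)

/-- The hyperbolic distance on the ball, given by
`cosh² (d(z,w)/2) = ⟨z̃, w̃⟩⟨w̃, z̃⟩ / (⟨z̃, z̃⟩⟨w̃, w̃⟩)`. -/
def hypDist (z w : Ball2) : ℝ :=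
  2 * Real.arcosh (‖herm (lift3 z.1) (lift3 w.1)‖ /
    Real.sqrt ((1 - normSq2 z.1) * (1 - normSq2 w.1)))

/-! # The quotient surface -/

/-- The quotient `X_Γ = Γ \ 𝔹²`, with the quotient topology. -/
abbrev PicardSurface (Γ : Subgroup SU21) : Type := MulAction.orbitRel.Quotient Γ Ball2

/-- The projection `𝔹² → X_Γ`. -/
def proj (Γ : Subgroup SU21) (z : Ball2) : PicardSurface Γ := Quotient.mk _ z

/-- The geodesic distance on `X_Γ`: the least distance between lifts of the two points. -/
def surfDist (Γ : Subgroup SU21) (x y : PicardSurface Γ) : ℝ :=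
  sInf {r | ∃ z w : Ball2, proj Γ z = x ∧ proj Γ w = y ∧ r = hypDist z w}

/-! # Pluricanonical forms -/

/-- The fibre of `Ω²` at a point of the ball: alternating complex-bilinear forms on the
holomorphic tangent space `ℂ²`. -/
abbrev Form2 : Type := (Fin 2 → ℂ) [⋀^Fin 2]→ₗ[ℂ] ℂ

/-- The fibre of `(Ω²)^{⊗k}` at a point of the ball. -/
abbrev PluriFibre (k : ℕ) : Type := PiTensorProduct ℂ (fun _ : Fin k => Form2)

/-- Pull-back of 2-forms under a linear map of tangent spaces. -/
def pullForm (L : (Fin 2 → ℂ) →ₗ[ℂ] (Fin 2 → ℂ)) : Form2 →ₗ[ℂ] Form2 where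
  toFun η := η.compLinearMap L
  map_add' _ _ := rfl
  map_smul' _ _ := rfl

/-- Pull-back of `k`-fold pluricanonical covectors under a linear map of tangent spaces. -/
def pullPluri (k : ℕ) (L : (Fin 2 → ℂ) →ₗ[ℂ] (Fin 2 → ℂ)) : PluriFibre k →ₗ[ℂ] PluriFibre k :=
  PiTensorProduct.map fun _ => pullForm L

/-- The form `dz₁ ∧ dz₂`. -/
def dzForm : Form2 := Matrix.detRowAlternating

/-- The frame `(dz₁ ∧ dz₂)^{⊗k}` of `(Ω²)^{⊗k}` on the ball. -/
def dzFrame (k : ℕ) : PluriFibre k := PiTensorProduct.tprod ℂ fun _ => dzForm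

/-- Coefficient of an element of `(Ω²)^{⊗k}` with respect to `(dz₁ ∧ dz₂)^{⊗k}`: it maps
`η₁ ⊗ ⋯ ⊗ η_k` to the product of the numbers `η_j(e₁, e₂)`. -/
def coeffDz (k : ℕ) : PluriFibre k →ₗ[ℂ] ℂ :=
  PiTensorProduct.lift
    ((MultilinearMap.mkPiAlgebra ℂ (Fin k) ℂ).compLinearMap fun _ =>
      { toFun := fun η : Form2 => η (fun i => Pi.single i 1)
        map_add' := fun _ _ => rfl
        map_smul' := fun _ _ => rfl })

theorem coeffDz_dzFrame (k : ℕ) : coeffDz k (dzFrame k) = 1 := by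
  have h : (fun i : Fin 2 => (Pi.single i 1 : Fin 2 → ℂ)) = (1 : Matrix (Fin 2) (Fin 2) ℂ) := by
    ext i j
    simp [Matrix.one_apply, Pi.single_apply, eq_comm]
  have h1 : dzForm (fun i : Fin 2 => (Pi.single i 1 : Fin 2 → ℂ)) = 1 := by
    rw [h]
    exact Matrix.det_one
  simp [coeffDz, dzFrame, h1]

/-- `H⁰(X_Γ, (Ω²)^{⊗k})`: the holomorphic sections of `(Ω²)^{⊗k}` on the ball that are invariant
under pull-back by every element of `Γ`, that is, that descend to `X_Γ = Γ \ 𝔹²`. -/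
def H0 (Γ : Subgroup SU21) (k : ℕ) : Submodule ℂ (Ball2 → PluriFibre k) where
  carrier := {ω |
    (∃ f : (Fin 2 → ℂ) → ℂ, DifferentiableOn ℂ f ballSet ∧
      ∀ z : Ball2, ω z = f z.1 • dzFrame k) ∧
    ∀ (γ : Γ) (z : Ball2),
      pullPluri k (fderiv ℂ (fracLin (γ : Matrix.SpecialLinearGroup (Fin 3) ℂ)) z.1 :
        (Fin 2 → ℂ) →ₗ[ℂ] (Fin 2 → ℂ)) (ω (γ • z)) = ω z}
  zero_mem' := ⟨⟨0, differentiableOn_const 0, fun z => by simp⟩, fun γ z => by simp⟩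
  add_mem' := by
    rintro ω η ⟨⟨f, hf, hωf⟩, hω⟩ ⟨⟨g, hg, hηg⟩, hη⟩
    refine ⟨⟨f + g, hf.add hg, fun z => ?_⟩, fun γ z => ?_⟩
    · simp [hωf z, hηg z, add_smul]
    · rw [Pi.add_apply, Pi.add_apply, map_add, hω γ z, hη γ z]
  smul_mem' := by
    rintro c ω ⟨⟨f, hf, hωf⟩, hω⟩
    refine ⟨⟨c • f, hf.const_smul c, fun z => ?_⟩, fun γ z => ?_⟩
    · simp [hωf z, mul_smul]
    · rw [Pi.smul_apply, Pi.smul_apply, map_smul, hω γ z]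

/-- The squared hyperbolic norm of `(dz₁ ∧ dz₂)^{⊗k}` at `z`. The metric induced on `Ω²` by the
Hermitian matrix `g` satisfies `|dz₁ ∧ dz₂|² = 1 / det g`, which is `(1 - |z|²)³`. -/
def frameNormSq (k : ℕ) (z : Ball2) : ℝ := (((hypMetric z).det.re)⁻¹) ^ k

/-- The point-wise Hermitian product on `(Ω²)^{⊗k}` at `z` induced by the hyperbolic metric. -/
def fibreInner (k : ℕ) (z : Ball2) (a b : PluriFibre k) : ℂ :=
  coeffDz k a * star (coeffDz k b) * (frameNormSq k z : ℂ)

/-- The `L²` inner product of sections over `X_Γ`, as an integral over the fundamental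
domain `F`. -/
def l2Inner (F : Set Ball2) (k : ℕ) (ω η : Ball2 → PluriFibre k) : ℂ :=
  ∫ z in F, fibreInner k z (ω z) (η z) ∂hypVol

/-- A basis of `H⁰(X_Γ, (Ω²)^{⊗k})` is orthonormal for the `L²` inner product. -/
def IsL2Orthonormal {Γ : Subgroup SU21} {k d : ℕ} (F : Set Ball2)
    (b : Module.Basis (Fin d) ℂ (H0 Γ k)) : Prop :=
  ∀ i j, l2Inner F k (b i).1 (b j).1 = if i = j then 1 else 0

/-- The Bergman kernel `∑_j ω_j(z) ⊗ conj (ω_j(w))` of a basis, written as a coefficient with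
respect to the frame `(dz₁ ∧ dz₂)^{⊗k} ⊗ conj (dw₁ ∧ dw₂)^{⊗k}`. -/
def bergmanKernel {Γ : Subgroup SU21} {k d : ℕ} (b : Module.Basis (Fin d) ℂ (H0 Γ k))
    (z w : Ball2) : ℂ :=
  ∑ j, coeffDz k ((b j).1 z) * star (coeffDz k ((b j).1 w))

/-- The point-wise hyperbolic norm of the Bergman kernel at `(z, w)`. -/
def bergmanNorm {Γ : Subgroup SU21} {k d : ℕ} (b : Module.Basis (Fin d) ℂ (H0 Γ k))
    (z w : Ball2) : ℝ :=
  ‖bergmanKernel b z w‖ * (Real.sqrt (frameNormSq k z) * Real.sqrt (frameNormSq k w))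

end

/-! The Bergman kernel of `X_Γ` is the `Γ`-average of the Bergman kernel of the ball, and that
average can be estimated term by term. Write `j(γ, z) = Cz + D` (`autFactor`) and `P(z, w) = 1 -
z·w̄` (`polar`). The Jacobian determinant of `γ` is `j⁻³`, so sections of `(Ω²)^{⊗k}` are
automorphic forms of weight `3k` (`mem_H0_iff`).

On the ball, `P(w, z)^{-3k}` reproduces holomorphic functions of bounded weighted norm, up to the
constant `ballWeight k` (`reproducing`). Unfolding over a fundamental domain turns this into the
statement that the Poincaré series `∑ (j(γ, z) P(γz, w))^{-3k}` represents `ballWeight k` times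
evaluation at `w`. Expanding it in an orthonormal basis identifies it with `ballWeight k` times the
Bergman kernel (`ballWeight_mul_bergmanKernel`).

Each term has point-wise norm exactly `cosh^{-3k}(d(γz, w)/2)` (`norm_poincareTerm`). Since `d(γz,
w)` is at least the distance on `X_Γ`, `3k - 8` of these factors leave the sum. The remaining sum of
`cosh^{-8}` is bounded uniformly in `z, w` by cocompactness (`exists_tsum_coshHalf_le`). The factor
`k²` comes from `ballWeight k ≥ c / k²` (`exists_le_ballWeight`). -/

noncomputable section
open Complex MeasureTheory

/-! ### The automorphy factor and the polarized form -/

/-- The denominator `C z + D` of the fractional linear map of `g`. -/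
def autFactor (g : SU21) (z : Fin 2 → ℂ) : ℂ :=
  ((g : Matrix.SpecialLinearGroup (Fin 3) ℂ) : Matrix (Fin 3) (Fin 3) ℂ).mulVec (lift3 z) 2

/-- The polarization `1 - z · w̄` of `1 - |z|²`. -/
def polar (z w : Fin 2 → ℂ) : ℂ := 1 - z 0 * star (w 0) - z 1 * star (w 1)

theorem herm_lift3 (z w : Fin 2 → ℂ) : herm (lift3 z) (lift3 w) = -polar z w := by
  rw [herm_apply]
  simp [lift3, polar]
  ring

theorem polar_self (z : Fin 2 → ℂ) : polar z z = ((1 - normSq2 z : ℝ) : ℂ) := by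
  simp only [polar, normSq2, Complex.star_def, Complex.mul_conj, Complex.normSq_eq_norm_sq]
  push_cast
  ring

theorem star_polar (z w : Fin 2 → ℂ) : star (polar z w) = polar w z := by
  simp [polar, mul_comm]

theorem smul_val (g : SU21) (z : Ball2) :
    (g • z).1 = fracLin (g : Matrix.SpecialLinearGroup (Fin 3) ℂ) z.1 := rfl

theorem autFactor_ne_zero (g : SU21) (z : Ball2) : autFactor g z.1 ≠ 0 :=
  denom_ne_zero g.2 z.2

theorem autFactor_smul_lift3 (g : SU21) (z : Ball2) :
    autFactor g z.1 • lift3 (g • z).1 =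
      ((g : Matrix.SpecialLinearGroup (Fin 3) ℂ) : Matrix (Fin 3) (Fin 3) ℂ).mulVec (lift3 z.1) :=
  smul_lift3_fracLin (denom_ne_zero g.2 z.2)

theorem autFactor_mul (g h : SU21) (z : Ball2) :
    autFactor (g * h) z.1 = autFactor g (h • z).1 * autFactor h z.1 := by
  have h1 := autFactor_smul_lift3 h z
  have h2 : autFactor (g * h) z.1 = ((g : Matrix.SpecialLinearGroup (Fin 3) ℂ) :
      Matrix (Fin 3) (Fin 3) ℂ).mulVec (((h : Matrix.SpecialLinearGroup (Fin 3) ℂ) :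
      Matrix (Fin 3) (Fin 3) ℂ).mulVec (lift3 z.1)) 2 := by
    rw [Matrix.mulVec_mulVec]
    rfl
  rw [h2, ← h1, Matrix.mulVec_smul, mul_comm]
  rfl

theorem autFactor_one (z : Fin 2 → ℂ) : autFactor 1 z = 1 := by
  simp [autFactor, lift3]

theorem autFactor_inv_smul (g : SU21) (z : Ball2) :
    autFactor g⁻¹ (g • z).1 * autFactor g z.1 = 1 := by
  rw [← autFactor_mul, inv_mul_cancel, autFactor_one]

theorem herm_smul_smul (a b : ℂ) (u v : Fin 3 → ℂ) :
    herm (a • u) (b • v) = a * star b * herm u v := by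
  simp only [herm_apply, Pi.smul_apply, smul_eq_mul, star_mul]
  ring

/-- Invariance of the Hermitian form, read in the affine chart through `g(z, 1) = j(g, z)(gz, 1)`.
The other transformation rules follow from it. -/
theorem polar_smul_smul (g : SU21) (z w : Ball2) :
    autFactor g z.1 * star (autFactor g w.1) * polar (g • z).1 (g • w).1 = polar z.1 w.1 := by
  have h := herm_mulVec g.2 (lift3 z.1) (lift3 w.1)
  rw [← autFactor_smul_lift3, ← autFactor_smul_lift3, herm_smul_smul, herm_lift3, herm_lift3] at h
  linear_combination -h

theorem one_sub_normSq2_smul (g : SU21) (z : Ball2) :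
    ‖autFactor g z.1‖ ^ 2 * (1 - normSq2 (g • z).1) = 1 - normSq2 z.1 := by
  have h := polar_smul_smul g z z
  rw [polar_self, polar_self, Complex.star_def, Complex.mul_conj, Complex.normSq_eq_norm_sq] at h
  exact_mod_cast h

/-- The symmetry of the automorphy factor under inversion of the group element. -/
theorem autFactor_mul_polar_smul (g : SU21) (z w : Ball2) :
    autFactor g z.1 * polar (g • z).1 w.1 =
      star (autFactor g⁻¹ w.1) * polar z.1 (g⁻¹ • w).1 := by
  have h := polar_smul_smul g z (g⁻¹ • w)
  rw [smul_inv_smul] at h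
  have h2 := autFactor_inv_smul g⁻¹ w
  rw [inv_inv] at h2
  have h3 : star (autFactor g (g⁻¹ • w).1) * star (autFactor g⁻¹ w.1) = 1 := by
    rw [← star_mul, mul_comm, h2, star_one]
  rw [← h]
  linear_combination -(autFactor g z.1 * polar (g • z).1 w.1) * h3

/-- The origin of the ball. -/
def origin : Ball2 := ⟨0, by simp [ballSet, normSq2]⟩

theorem polar_zero_right (z : Fin 2 → ℂ) : polar z 0 = 1 := by simp [polar]

/-- The case `w = 0` of the symmetry above. It separates the size of `g` from the dependence on `z`,
which stays bounded above and below for `z` in a smaller ball. -/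
theorem autFactor_eq (g : SU21) (z : Ball2) :
    autFactor g z.1 = star (autFactor g⁻¹ 0) * polar z.1 (g⁻¹ • origin).1 := by
  have h := autFactor_mul_polar_smul g z origin
  rwa [show origin.1 = 0 from rfl, polar_zero_right, mul_one] at h

/-! ### Bounds for the polarized form -/

theorem normSq2_nonneg (z : Fin 2 → ℂ) : 0 ≤ normSq2 z := by
  unfold normSq2; positivity

theorem normSq2_zero : normSq2 0 = 0 := by simp [normSq2]

theorem norm_one_sub_polar_le (z w : Fin 2 → ℂ) :
    ‖1 - polar z w‖ ≤ √(normSq2 z) * √(normSq2 w) := by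
  rw [← Real.sqrt_mul (normSq2_nonneg z)]
  apply Real.le_sqrt_of_sq_le
  have h1 : ‖1 - polar z w‖ ≤ ‖z 0‖ * ‖w 0‖ + ‖z 1‖ * ‖w 1‖ := by
    have : 1 - polar z w = z 0 * star (w 0) + z 1 * star (w 1) := by unfold polar; ring
    rw [this]
    refine (norm_add_le _ _).trans ?_
    simp
  calc ‖1 - polar z w‖ ^ 2 ≤ (‖z 0‖ * ‖w 0‖ + ‖z 1‖ * ‖w 1‖) ^ 2 := by gcongr
    _ ≤ _ := by
      unfold normSq2
      nlinarith [sq_nonneg (‖z 0‖ * ‖w 1‖ - ‖z 1‖ * ‖w 0‖)]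

theorem one_sub_sqrt_mul_le_norm_polar (z w : Fin 2 → ℂ) :
    1 - √(normSq2 z) * √(normSq2 w) ≤ ‖polar z w‖ := by
  have h := norm_one_sub_polar_le z w
  have h2 := norm_sub_norm_le (1 : ℂ) (1 - polar z w)
  rw [norm_one, sub_sub_cancel] at h2
  linarith

theorem sqrt_normSq2_lt_one (z : Ball2) : √(normSq2 z.1) < 1 := by
  rw [Real.sqrt_lt' one_pos, one_pow]
  exact z.2

theorem one_sub_sqrt_le_norm_polar (z w : Ball2) :
    1 - √(normSq2 z.1) ≤ ‖polar z.1 w.1‖ := by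
  refine le_trans ?_ (one_sub_sqrt_mul_le_norm_polar z.1 w.1)
  have := mul_le_mul_of_nonneg_left (sqrt_normSq2_lt_one w).le (Real.sqrt_nonneg (normSq2 z.1))
  linarith

theorem norm_polar_pos (z w : Ball2) : 0 < ‖polar z.1 w.1‖ :=
  (sub_pos.mpr (sqrt_normSq2_lt_one z)).trans_le (one_sub_sqrt_le_norm_polar z w)

theorem polar_ne_zero (z w : Ball2) : polar z.1 w.1 ≠ 0 := norm_pos_iff.mp (norm_polar_pos z w)

theorem norm_polar_le_two (z w : Ball2) : ‖polar z.1 w.1‖ ≤ 2 := by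
  have h := norm_one_sub_polar_le z.1 w.1
  have h2 := norm_sub_norm_le (polar z.1 w.1) 1
  rw [norm_one, norm_sub_rev] at h2
  have h3 := mul_le_mul (sqrt_normSq2_lt_one z).le (sqrt_normSq2_lt_one w).le
    (Real.sqrt_nonneg _) zero_le_one
  linarith

/-- With `a = |z|`, `b = |w|`, one has `|P(z, w)| ≥ 1 - ab`, and `(1 - ab)² - (1 - a²)(1 - b²) = (a
- b)²`. This puts the argument of `arcosh` in `[1, ∞)`. -/
theorem reverse_cauchy_schwarz (z w : Ball2) :
    (1 - normSq2 z.1) * (1 - normSq2 w.1) ≤ ‖polar z.1 w.1‖ ^ 2 := by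
  have hz := sqrt_normSq2_lt_one z
  have hw := sqrt_normSq2_lt_one w
  have hz0 := Real.sqrt_nonneg (normSq2 z.1)
  have hw0 := Real.sqrt_nonneg (normSq2 w.1)
  have h1 := one_sub_sqrt_mul_le_norm_polar z.1 w.1
  have hzs := Real.sq_sqrt (normSq2_nonneg z.1)
  have hws := Real.sq_sqrt (normSq2_nonneg w.1)
  set a := √(normSq2 z.1)
  set b := √(normSq2 w.1)
  rw [← hzs, ← hws]
  have hab : a * b ≤ 1 := by nlinarith
  calc (1 - a ^ 2) * (1 - b ^ 2) ≤ (1 - a * b) ^ 2 := by nlinarith [sq_nonneg (a - b)]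
    _ ≤ _ := by
      apply pow_le_pow_left₀ (by linarith) h1

/-! ### Transitivity on the ball -/

/-- An element of `SU(2,1)` that maps the origin to a prescribed point. -/
theorem exists_smul_origin (w : Ball2) : ∃ g : SU21, g • origin = w := by
  have hw := one_sub_normSq2_pos w
  set t : ℝ := 1 - normSq2 w.1 with ht
  obtain ⟨s, hs0, hs⟩ : ∃ s : ℝ, 0 < s ∧ s ^ 2 * t = 1 :=
    ⟨1 / √t, by positivity, by
      rw [div_pow, Real.sq_sqrt hw.le, one_pow, one_div, inv_mul_cancel₀ hw.ne']⟩
  -- This is `a = (s - 1) / |w|²`, rewritten without the division so that `w = 0` is allowed.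
  obtain ⟨a, ha⟩ : ∃ a : ℝ, a * (s + 1) = s ^ 2 := ⟨s ^ 2 / (s + 1), by field_simp⟩
  obtain ⟨x, hx⟩ : ∃ x, x = w.1 0 := ⟨_, rfl⟩
  obtain ⟨y, hy⟩ : ∃ y, y = w.1 1 := ⟨_, rfl⟩
  have hn : (t : ℂ) = 1 - x * star x - y * star y := by
    rw [hx, hy, ht, ← polar_self]; rfl
  have hs' : (s : ℂ) ^ 2 * (1 - x * star x - y * star y) = 1 := by
    rw [← hn]; exact_mod_cast hs
  have ha' : (a : ℂ) * (s + 1) = s ^ 2 := by exact_mod_cast ha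
  have hs1 : (s : ℂ) + 1 ≠ 0 := by
    have : (s + 1 : ℝ) ≠ 0 := by positivity
    exact_mod_cast this
  have hs2 : (s : ℂ) ≠ 0 := by exact_mod_cast hs0.ne'
  have hN : (a : ℂ) * (x * star x + y * star y) = s - 1 := by
    apply mul_left_cancel₀ hs1
    linear_combination (x * star x + y * star y) * ha' - hs'
  -- The boost along `w`: the upper block `1 + a w w*` stretches `w` by `s` and fixes its orthogonal
  -- complement; the last column is `s(w, 1)`, so the origin goes to `w`.
  let M : Matrix (Fin 3) (Fin 3) ℂ :=
    !![1 + a * x * star x, a * x * star y, s * x;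
       a * y * star x, 1 + a * y * star y, s * y;
       s * star x, s * star y, s]
  have hdet : M.det = 1 := by
    simp only [M, Matrix.det_fin_three, Matrix.of_apply, Matrix.cons_val', Matrix.cons_val_zero,
      Matrix.cons_val_one, Matrix.cons_val]
    linear_combination (s : ℂ) * hN + hs'
  have hform : M.conjTranspose * formH * M = formH := by
    have hR : (a : ℂ) * 2 + a ^ 2 * (x * star x + y * star y) - s ^ 2 = 0 := by
      linear_combination ha' + a * hN
    simp only [Complex.star_def] at hR hN hs'
    ext i j
    fin_cases i <;> fin_cases j <;>
    simp [M, formH, Matrix.mul_apply, Fin.sum_univ_three, Matrix.diagonal_apply]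
    · linear_combination (starRingEnd ℂ x * x) * hR
    · linear_combination (starRingEnd ℂ y * x) * hR
    · linear_combination (s * x) * hN
    · linear_combination (starRingEnd ℂ x * y) * hR
    · linear_combination (starRingEnd ℂ y * y) * hR
    · linear_combination (s * y) * hN
    · linear_combination (s * starRingEnd ℂ x) * hN
    · linear_combination (s * starRingEnd ℂ y) * hN
    · linear_combination -hs'
  refine ⟨⟨⟨M, hdet⟩, hform⟩, ?_⟩
  apply Subtype.ext
  rw [smul_val]
  funext i
  fin_cases i
  · simp [fracLin, M, lift3, origin, Matrix.mulVec, dotProduct, Fin.sum_univ_three]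
    field_simp
    exact hx
  · simp [fracLin, M, lift3, origin, Matrix.mulVec, dotProduct, Fin.sum_univ_three]
    field_simp
    exact hy

/-! ### Jacobians, and sections as automorphic forms -/

theorem measurable_normSq2 : Measurable normSq2 := by unfold normSq2; fun_prop

theorem continuous_normSq2 : Continuous normSq2 := by unfold normSq2; fun_prop

theorem isOpen_ballSet : IsOpen ballSet := isOpen_lt continuous_normSq2 continuous_const

theorem measurableSet_ballSet : MeasurableSet ballSet := isOpen_ballSet.measurableSet

/-- The linear part of the `i`-th coordinate of `z ↦ M (z, 1)`. -/
def rowMap (M : Matrix (Fin 3) (Fin 3) ℂ) (i : Fin 3) : (Fin 2 → ℂ) →L[ℂ] ℂ :=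
  M i 0 • ContinuousLinearMap.proj 0 + M i 1 • ContinuousLinearMap.proj 1

theorem rowMap_apply (M : Matrix (Fin 3) (Fin 3) ℂ) (i : Fin 3) (z : Fin 2 → ℂ) :
    rowMap M i z = M i 0 * z 0 + M i 1 * z 1 := rfl

theorem mulVec_lift3_apply (M : Matrix (Fin 3) (Fin 3) ℂ) (i : Fin 3) (z : Fin 2 → ℂ) :
    M.mulVec (lift3 z) i = rowMap M i z + M i 2 := by
  simp [Matrix.mulVec, dotProduct, Fin.sum_univ_three, lift3, rowMap_apply]

theorem hasFDerivAt_mulVec_lift3 (M : Matrix (Fin 3) (Fin 3) ℂ) (i : Fin 3) (z : Fin 2 → ℂ) :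
    HasFDerivAt (fun z => M.mulVec (lift3 z) i) (rowMap M i) z := by
  simp only [mulVec_lift3_apply]
  exact (rowMap M i).hasFDerivAt.add_const _

/-- The derivative of a fractional linear map. -/
def fracLinDeriv (M : Matrix (Fin 3) (Fin 3) ℂ) (z : Fin 2 → ℂ) :
    (Fin 2 → ℂ) →L[ℂ] (Fin 2 → ℂ) :=
  ContinuousLinearMap.pi fun i : Fin 2 =>
    ((M.mulVec (lift3 z) 2) ^ 2)⁻¹ •
      (M.mulVec (lift3 z) 2 • rowMap M i.castSucc - M.mulVec (lift3 z) i.castSucc • rowMap M 2)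

theorem hasFDerivAt_fracLin {M : Matrix (Fin 3) (Fin 3) ℂ} {z : Fin 2 → ℂ}
    (hd : M.mulVec (lift3 z) 2 ≠ 0) : HasFDerivAt (fracLin M) (fracLinDeriv M z) z := by
  rw [hasFDerivAt_pi']
  intro i
  have h := (hasFDerivAt_mulVec_lift3 M i.castSucc z).mul
    ((hasDerivAt_inv hd).comp_hasFDerivAt z (hasFDerivAt_mulVec_lift3 M 2 z))
  refine (h.congr_fderiv ?_).congr_of_eventuallyEq (Filter.Eventually.of_forall fun y => ?_)
  · ext v
    simp [fracLinDeriv]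
    field_simp
    ring
  · simp [fracLin, div_eq_mul_inv]

theorem det_fracLinDeriv {M : Matrix (Fin 3) (Fin 3) ℂ} (hM : M.det = 1) {z : Fin 2 → ℂ}
    (hd : M.mulVec (lift3 z) 2 ≠ 0) :
    LinearMap.det (fracLinDeriv M z : (Fin 2 → ℂ) →ₗ[ℂ] (Fin 2 → ℂ)) =
      ((M.mulVec (lift3 z) 2) ^ 3)⁻¹ := by
  rw [← LinearMap.det_toMatrix', Matrix.det_fin_two]
  simp only [LinearMap.toMatrix'_apply, fracLinDeriv, ContinuousLinearMap.coe_coe,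
    ContinuousLinearMap.coe_pi', smul_apply, sub_apply,
    rowMap_apply, smul_eq_mul]
  have h2 := mulVec_lift3_apply M 2 z
  have h0 := mulVec_lift3_apply M 0 z
  have h1 := mulVec_lift3_apply M 1 z
  rw [rowMap_apply] at h0 h1 h2
  set D := M.mulVec (lift3 z) 2
  set N := M.mulVec (lift3 z) 0
  set N' := M.mulVec (lift3 z) 1
  rw [Matrix.det_fin_three] at hM
  simp only [Fin.castSucc_zero, Fin.castSucc_one, Pi.single_apply, if_true, Fin.zero_eq_one_iff,
    Fin.one_eq_zero_iff, OfNat.ofNat_ne_one, if_false, mul_one, mul_zero, add_zero, zero_add]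
  change (D ^ 2)⁻¹ * (D * M 0 0 - N * M 2 0) * ((D ^ 2)⁻¹ * (D * M 1 1 - N' * M 2 1)) -
    (D ^ 2)⁻¹ * (D * M 0 1 - N * M 2 1) * ((D ^ 2)⁻¹ * (D * M 1 0 - N' * M 2 0)) = (D ^ 3)⁻¹
  -- Replacing the third column of `M` by `M(z, 1)` is a column operation, so the determinant stays
  -- 1; this is the expansion along that column.
  have key : D * (M 0 0 * M 1 1 - M 0 1 * M 1 0) - N' * (M 0 0 * M 2 1 - M 0 1 * M 2 0) -
      N * (M 1 1 * M 2 0 - M 1 0 * M 2 1) = 1 := by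
    rw [h0, h1, h2]
    linear_combination hM
  field_simp
  linear_combination D * key

theorem det_fderiv_smul (g : SU21) (z : Ball2) :
    LinearMap.det (fderiv ℂ (fracLin (g : Matrix.SpecialLinearGroup (Fin 3) ℂ)) z.1 :
      (Fin 2 → ℂ) →ₗ[ℂ] (Fin 2 → ℂ)) = ((autFactor g z.1) ^ 3)⁻¹ := by
  rw [(hasFDerivAt_fracLin (denom_ne_zero g.2 z.2)).fderiv]
  exact det_fracLinDeriv g.1.2 (denom_ne_zero g.2 z.2)

theorem pullForm_dzForm (L : (Fin 2 → ℂ) →ₗ[ℂ] (Fin 2 → ℂ)) :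
    pullForm L dzForm = LinearMap.det L • dzForm := by
  ext v
  change Matrix.det (Matrix.of fun i => L (v i)) = LinearMap.det L * Matrix.det (Matrix.of v)
  rw [← LinearMap.det_toMatrix', mul_comm, ← Matrix.det_transpose (LinearMap.toMatrix' L),
    ← Matrix.det_mul]
  congr 1
  ext i j
  rw [Matrix.of_apply, ← LinearMap.toMatrix'_mulVec L (v i)]
  simp [Matrix.mul_apply, Matrix.mulVec, dotProduct, mul_comm]

theorem pullPluri_dzFrame (k : ℕ) (L : (Fin 2 → ℂ) →ₗ[ℂ] (Fin 2 → ℂ)) :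
    pullPluri k L (dzFrame k) = LinearMap.det L ^ k • dzFrame k := by
  simp only [pullPluri, dzFrame, PiTensorProduct.map_tprod, pullForm_dzForm]
  rw [MultilinearMap.map_smul_univ (PiTensorProduct.tprod ℂ)]
  simp

theorem dzFrame_ne_zero (k : ℕ) : dzFrame k ≠ 0 := fun h => by
  have := coeffDz_dzFrame k
  simp [h] at this

/-- Pull-back multiplies the frame by the `k`-th power of the Jacobian determinant, that is by
`j^{-3k}`. From here on, sections are handled through their scalar coefficient `f`. -/
theorem mem_H0_iff {Γ : Subgroup SU21} {k : ℕ} {ω : Ball2 → PluriFibre k} :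
    ω ∈ H0 Γ k ↔ ∃ f : (Fin 2 → ℂ) → ℂ, DifferentiableOn ℂ f ballSet ∧
      (∀ z : Ball2, ω z = f z.1 • dzFrame k) ∧
      ∀ (γ : Γ) (z : Ball2), f (γ • z).1 = autFactor γ z.1 ^ (3 * k) * f z.1 := by
  have key : ∀ f : (Fin 2 → ℂ) → ℂ, (∀ z : Ball2, ω z = f z.1 • dzFrame k) →
      ((∀ (γ : Γ) (z : Ball2), pullPluri k (fderiv ℂ
        (fracLin (γ : Matrix.SpecialLinearGroup (Fin 3) ℂ)) z.1 :
        (Fin 2 → ℂ) →ₗ[ℂ] (Fin 2 → ℂ)) (ω (γ • z)) = ω z) ↔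
      ∀ (γ : Γ) (z : Ball2), f (γ • z).1 = autFactor γ z.1 ^ (3 * k) * f z.1) := by
    intro f hf
    refine forall₂_congr fun γ z => ?_
    rw [hf, hf, map_smul, pullPluri_dzFrame, det_fderiv_smul, smul_smul,
      smul_left_inj (dzFrame_ne_zero k), inv_pow, ← pow_mul]
    have h := pow_ne_zero (3 * k) (autFactor_ne_zero γ z)
    rw [mul_inv_eq_iff_eq_mul₀ h, mul_comm (f z.1)]
  constructor
  · rintro ⟨⟨f, hf, hωf⟩, h⟩
    exact ⟨f, hf, hωf, (key f hωf).1 h⟩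
  · rintro ⟨f, hf, hωf, h⟩
    exact ⟨⟨f, hf, hωf⟩, (key f hωf).2 h⟩

theorem frameNormSq_eq (k : ℕ) (z : Ball2) : frameNormSq k z = (1 - normSq2 z.1) ^ (3 * k) := by
  rw [frameNormSq, hypMetric_det, Complex.ofReal_re, one_div, inv_inv, pow_mul]

/-! ### Invariance of the hyperbolic volume -/

instance : ContinuousConstSMul SU21 Ball2 where
  continuous_const_smul g := by
    apply Continuous.subtype_mk
    rw [continuous_iff_continuousAt]
    intro z
    exact (hasFDerivAt_fracLin (denom_ne_zero g.2 z.2)).continuousAt.comp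
      continuous_subtype_val.continuousAt

instance : MeasurableConstSMul SU21 Ball2 where
  measurable_const_smul g := (continuous_const_smul g).measurable

theorem measurable_hypDensity :
    Measurable fun z : Fin 2 → ℂ => ENNReal.ofReal (1 / (1 - normSq2 z) ^ 3) :=
  (((measurable_const.sub measurable_normSq2).pow_const 3).const_div 1).ennreal_ofReal

theorem measurable_hypDensity_ball :
    Measurable fun z : Ball2 => ENNReal.ofReal (1 / (1 - normSq2 z.1) ^ 3) :=
  measurable_hypDensity.comp measurable_subtype_coe

theorem hypVol_apply {s : Set Ball2} (hs : MeasurableSet s) :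
    hypVol s = ∫⁻ z in Subtype.val '' s, ENNReal.ofReal (1 / (1 - normSq2 z) ^ 3) := by
  have he : MeasurableEmbedding (Subtype.val : Ball2 → Fin 2 → ℂ) :=
    MeasurableEmbedding.subtype_coe measurableSet_ballSet
  have hc := lintegral_subtype_comap (μ := volume) measurableSet_ballSet
    ((Subtype.val '' s).indicator fun z => ENNReal.ofReal (1 / (1 - normSq2 z) ^ 3))
  rw [lintegral_indicator (he.measurableSet_image.2 hs),
    Measure.restrict_restrict (he.measurableSet_image.2 hs),
    Set.inter_eq_left.2 (by rintro _ ⟨z, -, rfl⟩; exact z.2)] at hc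
  rw [hypVol, withDensity_apply _ hs, ← hc, ← lintegral_indicator hs]
  refine lintegral_congr fun z => ?_
  by_cases hz : z ∈ s <;> simp [Set.indicator, hz]

/-- The real Jacobian is `|j⁻³|² = |j|⁻⁶`, while `1 - |gz|² = |j|⁻²(1 - |z|²)`; the cube in the
density compensates exactly. -/
instance : SMulInvariantMeasure SU21 Ball2 hypVol where
  measure_preimage_smul g s hs := by
    have hpre : MeasurableSet ((fun z : Ball2 => g • z) ⁻¹' s) := measurable_const_smul g hs
    have himg : Subtype.val '' s = fracLin (g : Matrix.SpecialLinearGroup (Fin 3) ℂ) ''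
        (Subtype.val '' ((fun z : Ball2 => g • z) ⁻¹' s)) := by
      ext z
      constructor
      · rintro ⟨z, hz, rfl⟩
        exact ⟨_, ⟨g⁻¹ • z, by simpa using hz, rfl⟩, by rw [← smul_val, smul_inv_smul]⟩
      · rintro ⟨_, ⟨z, hz, rfl⟩, rfl⟩
        exact ⟨g • z, hz, rfl⟩
    have hm : MeasurableSet (Subtype.val '' ((fun z : Ball2 => g • z) ⁻¹' s)) :=
      (MeasurableEmbedding.subtype_coe measurableSet_ballSet).measurableSet_image.2 hpre
    rw [hypVol_apply hpre, hypVol_apply hs, himg, lintegral_image_eq_lintegral_abs_det_fderiv_mul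
      volume hm (f' := fun z => (fracLinDeriv (g : Matrix.SpecialLinearGroup (Fin 3) ℂ)
        z).restrictScalars ℝ)]
    · refine setLIntegral_congr_fun hm ?_
      rintro _ ⟨z, -, rfl⟩
      have h1 := one_sub_normSq2_smul g z
      have h2 := norm_pos_iff.mpr (autFactor_ne_zero g z)
      have h3 := one_sub_normSq2_pos z
      have h4 := one_sub_normSq2_pos (g • z)
      have hdet : ((fracLinDeriv (g : Matrix.SpecialLinearGroup (Fin 3) ℂ)
        z.1).restrictScalars ℝ).det = (‖autFactor g z.1‖ ^ 6)⁻¹ := by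
        have := det_fracLinDeriv g.1.2 (denom_ne_zero g.2 z.2)
        change LinearMap.det ((fracLinDeriv (g : Matrix.SpecialLinearGroup (Fin 3) ℂ)
          z.1 : (Fin 2 → ℂ) →ₗ[ℂ] (Fin 2 → ℂ)).restrictScalars ℝ) = _
        rw [LinearMap.det_restrictScalars, this, Algebra.norm_complex_apply,
          Complex.normSq_eq_norm_sq, norm_inv, norm_pow, inv_pow, ← pow_mul]
        rfl
      beta_reduce
      rw [hdet, ← smul_val, ← ENNReal.ofReal_mul (abs_nonneg _), abs_of_pos (by positivity), ← h1]
      congr 1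
      field_simp
    · rintro _ ⟨z, -, rfl⟩
      exact ((hasFDerivAt_fracLin (denom_ne_zero g.2 z.2)).restrictScalars ℝ).hasFDerivWithinAt
    · rintro _ ⟨z, -, rfl⟩ _ ⟨w, -, rfl⟩ h
      rw [← smul_val, ← smul_val] at h
      rw [MulAction.injective g (Subtype.ext h)]

theorem integral_hypVol (h : (Fin 2 → ℂ) → ℂ) :
    ∫ z : Ball2, h z.1 ∂hypVol =
      ∫ z in ballSet, ((1 / (1 - normSq2 z) ^ 3 : ℝ) : ℂ) * h z := by
  rw [hypVol, integral_withDensity_eq_integral_toReal_smul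
    measurable_hypDensity_ball
    (Filter.Eventually.of_forall fun _ => ENNReal.ofReal_lt_top),
    ← integral_subtype_comap measurableSet_ballSet]
  refine integral_congr_ae (Filter.Eventually.of_forall fun z => ?_)
  have := one_sub_normSq2_pos z
  beta_reduce
  rw [ENNReal.toReal_ofReal (by positivity), Complex.real_smul]

theorem integrable_hypVol_iff (h : (Fin 2 → ℂ) → ℂ) :
    Integrable (fun z : Ball2 => h z.1) hypVol ↔
      IntegrableOn (fun z => ((1 / (1 - normSq2 z) ^ 3 : ℝ) : ℂ) * h z) ballSet := by
  rw [hypVol, integrable_withDensity_iff_integrable_smul'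
    measurable_hypDensity_ball
    (Filter.Eventually.of_forall fun _ => ENNReal.ofReal_lt_top),
    integrableOn_iff_comap_subtypeVal measurableSet_ballSet]
  refine integrable_congr (Filter.Eventually.of_forall fun z => ?_)
  have := one_sub_normSq2_pos z
  simp only [Function.comp_apply]
  rw [ENNReal.toReal_ofReal (by positivity), Complex.real_smul]

instance (Γ : Subgroup SU21) : ContinuousConstSMul Γ Ball2 where
  continuous_const_smul γ := continuous_const_smul (γ : SU21)

theorem countable_of_discreteTopology (Γ : Subgroup SU21) [DiscreteTopology Γ] :
    Countable Γ := by
  have : SecondCountableTopology (Matrix (Fin 3) (Fin 3) ℂ) :=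
    inferInstanceAs (SecondCountableTopology (Fin 3 → Fin 3 → ℂ))
  have : SecondCountableTopology (Matrix.SpecialLinearGroup (Fin 3) ℂ) :=
    TopologicalSpace.Subtype.secondCountableTopology
      {A : Matrix (Fin 3) (Fin 3) ℂ | A.det = 1}
  exact countable_of_Lindelof_of_discrete

/-! ### The mean value property on the ball -/

theorem norm_le_one_of_mem_ballSet {z : Fin 2 → ℂ} (hz : z ∈ ballSet) : ‖z‖ ≤ 1 := by
  have hz' : ‖z 0‖ ^ 2 + ‖z 1‖ ^ 2 < 1 := hz
  rw [pi_norm_le_iff_of_nonneg zero_le_one]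
  intro i
  rw [← sq_le_one_iff₀ (norm_nonneg _)]
  fin_cases i
  · exact (by nlinarith [sq_nonneg ‖z 1‖] : ‖z 0‖ ^ 2 ≤ 1)
  · exact (by nlinarith [sq_nonneg ‖z 0‖] : ‖z 1‖ ^ 2 ≤ 1)

theorem volume_ballSet_lt_top : volume ballSet < ⊤ :=
  (measure_mono fun _ hz => mem_closedBall_zero_iff.2 (norm_le_one_of_mem_ballSet hz)).trans_lt
    (measure_closedBall_lt_top (x := (0 : Fin 2 → ℂ)) (r := 1))

theorem integrableOn_ballSet_of_bound {h : (Fin 2 → ℂ) → ℂ} (hc : ContinuousOn h ballSet) (M : ℝ)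
    (hb : ∀ z ∈ ballSet, ‖h z‖ ≤ M) : IntegrableOn h ballSet :=
  IntegrableOn.of_bound volume_ballSet_lt_top (hc.aestronglyMeasurable measurableSet_ballSet) M
    ((ae_restrict_iff' measurableSet_ballSet).2 (Filter.Eventually.of_forall hb))

theorem normSq2_smul (c : ℂ) (z : Fin 2 → ℂ) : normSq2 (c • z) = ‖c‖ ^ 2 * normSq2 z := by
  simp [normSq2]
  ring

theorem measurePreserving_smul_of_norm_eq_one {c : ℂ} (hc : ‖c‖ = 1) :
    MeasurePreserving (fun z : Fin 2 → ℂ => c • z) := by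
  have h := volume_preserving_pi (ι := Fin 2) (f := fun _ => rotation ⟨c, mem_sphere_zero_iff_norm.2 hc⟩)
    fun _ => LinearIsometryEquiv.measurePreserving _
  exact h

theorem smul_mem_ballSet_iff {c : ℂ} (hc : ‖c‖ = 1) (z : Fin 2 → ℂ) :
    c • z ∈ ballSet ↔ z ∈ ballSet := by
  simp only [ballSet, Set.mem_ofPred_eq, normSq2_smul, hc, one_pow, one_mul]

theorem setIntegral_ballSet_smul (h : (Fin 2 → ℂ) → ℂ) {c : ℂ} (hc : ‖c‖ = 1) :
    ∫ z in ballSet, h (c • z) = ∫ z in ballSet, h z := by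
  have hp := measurePreserving_smul_of_norm_eq_one hc
  have hc0 : c ≠ 0 := by rintro rfl; simp at hc
  have he : MeasurableEmbedding (fun z : Fin 2 → ℂ => c • z) := measurableEmbedding_const_smul₀ hc0
  have := hp.setIntegral_preimage_emb he h ballSet
  rwa [show (fun z : Fin 2 → ℂ => c • z) ⁻¹' ballSet = ballSet from
    Set.ext (smul_mem_ballSet_iff hc)] at this

theorem norm_circleMap_zero_one (θ : ℝ) : ‖circleMap 0 1 θ‖ = 1 := by simp

theorem setIntegral_ballSet_circleAverage {h : (Fin 2 → ℂ) → ℂ} (hcont : ContinuousOn h ballSet)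
    (M : ℝ) (hb : ∀ z ∈ ballSet, ‖h z‖ ≤ M) :
    ∫ z in ballSet, Real.circleAverage (fun c => h (c • z)) 0 1 = ∫ z in ballSet, h z := by
  have hpi : (0 : ℝ) ≤ 2 * Real.pi := by positivity
  simp only [Real.circleAverage_def, intervalIntegral.integral_of_le hpi]
  rw [integral_smul, integral_integral_swap]
  · simp only [setIntegral_ballSet_smul h (norm_circleMap_zero_one _)]
    simp [max_eq_left hpi]
    field_simp
  · have hfin : IsFiniteMeasure (volume.restrict ballSet) := ⟨by
      rw [Measure.restrict_apply_univ]; exact volume_ballSet_lt_top⟩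
    -- `h` is controlled only on the ball; extension by zero gives a function measurable on the
    -- whole product, as Fubini requires.
    have hm : Measurable (ballSet.indicator h) := by
      classical
      rw [← Set.piecewise_eq_indicator]
      exact hcont.measurable_piecewise continuousOn_const measurableSet_ballSet
    have hsm : StronglyMeasurable fun p : (Fin 2 → ℂ) × ℝ =>
        ballSet.indicator h (circleMap 0 1 p.2 • p.1) := by
      refine (hm.comp ?_).stronglyMeasurable
      exact (((continuous_circleMap 0 1).comp continuous_snd).smul continuous_fst).measurable
    have hi : Integrable (fun p : (Fin 2 → ℂ) × ℝ => ballSet.indicator h (circleMap 0 1 p.2 • p.1))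
        ((volume.restrict ballSet).prod (volume.restrict (Set.Ioc 0 (2 * Real.pi)))) := by
      refine Integrable.of_bound hsm.aestronglyMeasurable (max M 0)
        (Filter.Eventually.of_forall fun p => ?_)
      by_cases hp : circleMap 0 1 p.2 • p.1 ∈ ballSet
      · rw [Set.indicator_of_mem hp]
        exact (hb _ hp).trans (le_max_left _ _)
      · rw [Set.indicator_of_notMem hp, norm_zero]
        exact le_max_right _ _
    refine hi.congr ?_
    rw [Measure.prod_restrict]
    refine (ae_restrict_iff' (measurableSet_ballSet.prod measurableSet_Ioc)).2
      (Filter.Eventually.of_forall fun p hp => ?_)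
    exact Set.indicator_of_mem ((smul_mem_ballSet_iff (norm_circleMap_zero_one _) _).2 hp.1) h

/-- The one-variable mean value property for `c ↦ f(cz)`, which is holomorphic near the closed unit
disc because `z` lies in the open ball. -/
theorem circleAverage_smul_eq {f : (Fin 2 → ℂ) → ℂ} (hf : DifferentiableOn ℂ f ballSet)
    {z : Fin 2 → ℂ} (hz : z ∈ ballSet) : Real.circleAverage (fun c => f (c • z)) 0 1 = f 0 := by
  have hd : ∀ c ∈ Metric.closedBall (0 : ℂ) |1|, DifferentiableAt ℂ (fun c : ℂ => f (c • z)) c := by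
    intro c hc
    rw [abs_one, mem_closedBall_zero_iff] at hc
    have hmem : c • z ∈ ballSet := by
      have hz' : normSq2 z < 1 := hz
      change normSq2 (c • z) < 1
      rw [normSq2_smul]
      have : ‖c‖ ^ 2 ≤ 1 := pow_le_one₀ (norm_nonneg _) hc
      nlinarith [normSq2_nonneg z]
    exact DifferentiableAt.comp (g := f) c (hf.differentiableAt (isOpen_ballSet.mem_nhds hmem))
      (differentiableAt_id.smul_const z)
  have := circleAverage_of_differentiable_on_off_countable (s := ∅) (R := 1) (c := (0 : ℂ))
    (f := fun c : ℂ => f (c • z)) Set.countable_empty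
    (fun c hc => (hd c hc).continuousAt.continuousWithinAt)
    (fun c hc => hd c (Metric.ball_subset_closedBall hc.1))
  simpa using this

/-- The mean value property for a radial weight on the ball. -/
theorem setIntegral_ballSet_radial {f : (Fin 2 → ℂ) → ℂ} (hf : DifferentiableOn ℂ f ballSet)
    {ρ : ℝ → ℂ} (hρ : Continuous ρ) (M : ℝ) (hb : ∀ z ∈ ballSet, ‖ρ (normSq2 z) * f z‖ ≤ M) :
    ∫ z in ballSet, ρ (normSq2 z) * f z = (∫ z in ballSet, ρ (normSq2 z)) * f 0 := by
  rw [← setIntegral_ballSet_circleAverage (h := fun z => ρ (normSq2 z) * f z)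
    ((hρ.comp continuous_normSq2).continuousOn.mul hf.continuousOn) M hb, ← integral_mul_const]
  refine setIntegral_congr_fun measurableSet_ballSet fun z hz => ?_
  rw [← circleAverage_smul_eq hf hz, ← smul_eq_mul, ← Real.circleAverage_fun_smul]
  refine Real.circleAverage_congr_sphere fun c hc => ?_
  have hc1 : ‖c‖ = 1 := by simpa using hc
  simp [normSq2_smul, hc1]

/-! ### The reproducing kernel of the ball -/

/-- The normalizing integral of the weighted Bergman kernel of the ball. -/
def ballWeight (k : ℕ) : ℝ := ∫ z in ballSet, (1 - normSq2 z) ^ (3 * k - 3)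

/-- The weight is at least 1/2 on a ball of radius of order `k^{-1/2}`, whose volume in real
dimension 4 is of order `k⁻²`. -/
theorem exists_le_ballWeight : ∃ c : ℝ, 0 < c ∧ ∀ k : ℕ, 1 ≤ k → c / (k : ℝ) ^ 2 ≤ ballWeight k := by
  set V := (volume (Metric.ball (0 : Fin 2 → ℂ) 1)).toReal with hV
  have hVpos : 0 < V := ENNReal.toReal_pos (Metric.measure_ball_pos _ _ one_pos).ne'
    measure_ball_lt_top.ne
  -- With `r² = 1/(12k)`, the sup-norm ball of radius `r` lies in `|z|² ≤ 1/(6k)`, where Bernoulli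
  -- gives a weight of at least `1 - 3k/(6k) = 1/2`. Its volume is `V r⁴ = V/(144k²)`, and half of
  -- that is `V/(288k²)`.
  refine ⟨V / 288, by positivity, fun k hk => ?_⟩
  have hk' : (1 : ℝ) ≤ k := by exact_mod_cast hk
  set r : ℝ := √(1 / (12 * k)) with hr
  have hr2 : r ^ 2 = 1 / (12 * k) := Real.sq_sqrt (by positivity)
  have hr0 : 0 < r := by positivity
  have hsmall : ∀ z ∈ Metric.ball (0 : Fin 2 → ℂ) r, normSq2 z ≤ 1 / (6 * k) := by
    intro z hz
    rw [mem_ball_zero_iff] at hz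
    have h : ∀ i, ‖z i‖ ^ 2 ≤ 1 / (12 * k) := fun i => by
      rw [← hr2]
      exact pow_le_pow_left₀ (norm_nonneg _) ((norm_le_pi_norm z i).trans hz.le) 2
    have : (1 : ℝ) / (6 * k) = 1 / (12 * k) + 1 / (12 * k) := by field_simp; norm_num
    rw [this]
    exact add_le_add (h 0) (h 1)
  have h6 : (1 : ℝ) / (6 * k) ≤ 1 / 6 := by gcongr; linarith
  have hsub : Metric.ball (0 : Fin 2 → ℂ) r ⊆ ballSet := fun z hz =>
    lt_of_le_of_lt ((hsmall z hz).trans h6) (by norm_num)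
  have hint : IntegrableOn (fun z => (1 - normSq2 z) ^ (3 * k - 3)) ballSet := by
    refine IntegrableOn.of_bound volume_ballSet_lt_top (Continuous.aestronglyMeasurable
      ((continuous_const.sub continuous_normSq2).pow _)) 1
      ((ae_restrict_iff' measurableSet_ballSet).2 (Filter.Eventually.of_forall fun z hz => ?_))
    have h1 : 0 < 1 - normSq2 z := sub_pos.mpr hz
    rw [Real.norm_of_nonneg (by positivity)]
    exact pow_le_one₀ h1.le (by linarith [normSq2_nonneg z])
  calc V / 288 / (k : ℝ) ^ 2
      = ∫ z in Metric.ball (0 : Fin 2 → ℂ) r, (1 / 2 : ℝ) := by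
        rw [setIntegral_const, measureReal_def, Measure.addHaar_ball_of_pos _ _ hr0,
          ENNReal.toReal_mul, ENNReal.toReal_ofReal (by positivity), ← hV,
          show Module.finrank ℝ (Fin 2 → ℂ) = 2 * 2 by
            simp [Module.finrank_pi_fintype, Complex.finrank_real_complex], pow_mul, hr2, smul_eq_mul]
        field_simp
        norm_num
    _ ≤ ∫ z in Metric.ball (0 : Fin 2 → ℂ) r, (1 - normSq2 z) ^ (3 * k - 3) := by
        refine setIntegral_mono_on (integrableOn_const measure_ball_lt_top.ne)
          (hint.mono_set hsub) measurableSet_ball fun z hz => ?_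
        have h1 := hsmall z hz
        have h2 := one_add_mul_le_pow (a := -normSq2 z) (by linarith) (3 * k - 3)
        rw [← sub_eq_add_neg] at h2
        refine le_trans ?_ h2
        have h3 : ((3 * k - 3 : ℕ) : ℝ) ≤ 3 * k := by
          exact_mod_cast Nat.sub_le _ _
        have h4 : ((3 * k - 3 : ℕ) : ℝ) * normSq2 z ≤ 3 * k * (1 / (6 * k)) :=
          mul_le_mul h3 h1 (normSq2_nonneg z) (by positivity)
        have h5 : (3 : ℝ) * k * (1 / (6 * k)) = 1 / 2 := by field_simp; norm_num
        linarith
    _ ≤ ballWeight k := by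
        refine setIntegral_mono_set hint ?_ hsub.eventuallyLE
        refine (ae_restrict_iff' measurableSet_ballSet).2 (Filter.Eventually.of_forall fun z hz => ?_)
        have h1 : 0 < 1 - normSq2 z := sub_pos.mpr hz
        exact pow_nonneg h1.le _

theorem reproducing_origin {f : (Fin 2 → ℂ) → ℂ} (hf : DifferentiableOn ℂ f ballSet) {k : ℕ}
    (hk : 2 ≤ k) {M : ℝ} (hb : ∀ z : Ball2, ‖f z.1‖ ^ 2 * (1 - normSq2 z.1) ^ (3 * k) ≤ M) :
    ∫ z : Ball2, f z.1 * ((1 - normSq2 z.1 : ℝ) : ℂ) ^ (3 * k) ∂hypVol = f 0 * ballWeight k := by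
  rw [integral_hypVol (fun z => f z * ((1 - normSq2 z : ℝ) : ℂ) ^ (3 * k))]
  have h1 := setIntegral_ballSet_radial hf (ρ := fun t : ℝ => ((1 - t : ℝ) : ℂ) ^ (3 * k - 3))
    (by fun_prop) (√M) (fun z hz => by
      refine Real.le_sqrt_of_sq_le (le_trans ?_ (hb ⟨z, hz⟩))
      have h1 : 0 < 1 - normSq2 z := sub_pos.mpr hz
      rw [norm_mul, norm_pow, Complex.norm_real, Real.norm_of_nonneg h1.le, mul_pow, mul_comm,
        ← pow_mul]
      gcongr ?_ * ?_
      -- The condition `2 ≤ k` enters as `3k ≤ 2(3k - 3)`.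
      exact pow_le_pow_of_le_one h1.le (by linarith [normSq2_nonneg z]) (by omega))
  rw [mul_comm (f 0), ballWeight, ← integral_complex_ofReal]
  push_cast at h1 ⊢
  rw [← h1]
  refine setIntegral_congr_fun measurableSet_ballSet fun z hz => ?_
  have h1 : 0 < 1 - normSq2 z := sub_pos.mpr hz
  have h2 : (1 - normSq2 z : ℂ) ≠ 0 := by exact_mod_cast h1.ne'
  have h3 : (1 - normSq2 z : ℂ) ^ (3 * k) = (1 - normSq2 z : ℂ) ^ (3 * k - 3) *
      (1 - normSq2 z : ℂ) ^ 3 := by rw [← pow_add]; congr 1; omega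
  rw [h3]
  field_simp

theorem differentiableOn_comp_smul {f : (Fin 2 → ℂ) → ℂ} (hf : DifferentiableOn ℂ f ballSet)
    (g : SU21) : DifferentiableOn ℂ
      (fun z => f (fracLin (g : Matrix.SpecialLinearGroup (Fin 3) ℂ) z)) ballSet :=
  hf.comp (fun _ hz => (hasFDerivAt_fracLin
    (denom_ne_zero g.2 hz)).differentiableAt.differentiableWithinAt) fun _ hz => fracLin_mem g.2 hz

theorem differentiable_autFactor (g : SU21) : Differentiable ℂ (autFactor g) := fun z =>
  (hasFDerivAt_mulVec_lift3 _ 2 z).differentiableAt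

/-- The reproducing property of the weighted Bergman kernel of the ball. -/
theorem reproducing {f : (Fin 2 → ℂ) → ℂ} (hf : DifferentiableOn ℂ f ballSet) {k : ℕ}
    (hk : 2 ≤ k) {M : ℝ} (hb : ∀ z : Ball2, ‖f z.1‖ ^ 2 * (1 - normSq2 z.1) ^ (3 * k) ≤ M)
    (w : Ball2) :
    ∫ z : Ball2, f z.1 * ((polar w.1 z.1)⁻¹) ^ (3 * k) *
      ((1 - normSq2 z.1 : ℝ) : ℂ) ^ (3 * k) ∂hypVol = f w.1 * ballWeight k := by
  obtain ⟨g, hg⟩ := exists_smul_origin w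
  -- The weight-`3k` transform of `f` by `g`: it satisfies the same norm bound, and its value at the
  -- origin is `f(w)` up to a power of `j(g, 0)`. The formula at `w` thus reduces to the one at the
  -- origin.
  set F : (Fin 2 → ℂ) → ℂ := fun z =>
    f (fracLin (g : Matrix.SpecialLinearGroup (Fin 3) ℂ) z) * ((autFactor g z)⁻¹) ^ (3 * k) with hF
  have hFz : ∀ z : Ball2, F z.1 = f (g • z).1 * ((autFactor g z.1)⁻¹) ^ (3 * k) := fun z => rfl
  have hFd : DifferentiableOn ℂ F ballSet := (differentiableOn_comp_smul hf g).mul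
    (((differentiable_autFactor g).differentiableOn.inv fun z hz =>
      autFactor_ne_zero g ⟨z, hz⟩).pow _)
  have hFb : ∀ z : Ball2, ‖F z.1‖ ^ 2 * (1 - normSq2 z.1) ^ (3 * k) ≤ M := by
    intro z
    refine le_of_eq_of_le ?_ (hb (g • z))
    have h2 := norm_pos_iff.mpr (autFactor_ne_zero g z)
    rw [hFz, ← one_sub_normSq2_smul g z, norm_mul, norm_pow, norm_inv]
    simp only [mul_pow, inv_pow, ← pow_mul, mul_comm (3 * k) 2]
    field_simp
  have h := reproducing_origin hFd hk hFb
  rw [← integral_smul_eq_self _ (g := g)]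
  have h0 : F 0 = f w.1 * ((autFactor g 0)⁻¹) ^ (3 * k) := by
    rw [← hg]; exact hFz origin
  have ha0 : autFactor g 0 ≠ 0 := autFactor_ne_zero g origin
  have hcalc : ∀ z : Ball2, f (g • z).1 * ((polar w.1 (g • z).1)⁻¹) ^ (3 * k) *
      ((1 - normSq2 (g • z).1 : ℝ) : ℂ) ^ (3 * k) =
      autFactor g 0 ^ (3 * k) * (F z.1 * ((1 - normSq2 z.1 : ℝ) : ℂ) ^ (3 * k)) := by
    intro z
    have h1 := polar_smul_smul g origin z
    have h2 := polar_smul_smul g z z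
    have haz := autFactor_ne_zero g z
    rw [hg, ← star_polar z.1 origin.1, show origin.1 = 0 from rfl, polar_zero_right, star_one] at h1
    have h3 : (polar w.1 (g • z).1)⁻¹ = autFactor g 0 * star (autFactor g z.1) :=
      inv_eq_of_mul_eq_one_left h1
    rw [← polar_self, ← polar_self, ← h2, h3, hFz]
    simp only [mul_pow, inv_pow]
    field_simp
  rw [integral_congr_ae (Filter.Eventually.of_forall hcalc), integral_const_mul, h, h0, inv_pow]
  field_simp

/-! ### Size of the automorphy factor and the hyperbolic distance -/

theorem norm_autFactor_inv_zero (g : SU21) : ‖autFactor g⁻¹ 0‖ = ‖autFactor g 0‖ := by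
  have h := autFactor_eq g origin
  have hp : polar origin.1 (g⁻¹ • origin).1 = 1 := by simp [polar, origin]
  rw [hp, mul_one] at h
  rw [show autFactor g 0 = _ from h, norm_star]

theorem norm_autFactor_eq (g : SU21) (z : Ball2) :
    ‖autFactor g z.1‖ = ‖autFactor g 0‖ * ‖polar z.1 (g⁻¹ • origin).1‖ := by
  rw [autFactor_eq, norm_mul, norm_star, norm_autFactor_inv_zero]

theorem one_le_norm_autFactor_zero (g : SU21) : 1 ≤ ‖autFactor g 0‖ := by
  have h := one_sub_normSq2_smul g origin
  rw [show origin.1 = 0 from rfl, normSq2_zero, sub_zero] at h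
  have h1 := normSq2_nonneg (g • origin).1
  rw [← one_le_sq_iff₀ (norm_nonneg _)]
  nlinarith [sq_nonneg ‖autFactor g 0‖]

theorem norm_polar_comm (z w : Fin 2 → ℂ) : ‖polar z w‖ = ‖polar w z‖ := by
  rw [← star_polar, norm_star]

theorem le_norm_autFactor_inv (g : SU21) (w : Ball2) :
    ‖autFactor g 0‖ * (1 - √(normSq2 w.1)) ≤ ‖autFactor g⁻¹ w.1‖ := by
  rw [norm_autFactor_eq, norm_autFactor_inv_zero]
  exact mul_le_mul_of_nonneg_left (one_sub_sqrt_le_norm_polar w _) (norm_nonneg _)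

/-- The quantity `cosh (d(z, w) / 2)`. -/
def coshHalf (z w : Ball2) : ℝ := ‖polar z.1 w.1‖ / √((1 - normSq2 z.1) * (1 - normSq2 w.1))

theorem hypDist_eq (z w : Ball2) : hypDist z w = 2 * Real.arcosh (coshHalf z w) := by
  rw [hypDist, herm_lift3, norm_neg, coshHalf]

theorem one_le_coshHalf (z w : Ball2) : 1 ≤ coshHalf z w := by
  have hz := one_sub_normSq2_pos z
  have hw := one_sub_normSq2_pos w
  rw [coshHalf, one_le_div (by positivity)]
  exact Real.sqrt_le_iff.2 ⟨norm_nonneg _, reverse_cauchy_schwarz z w⟩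

theorem cosh_hypDist (z w : Ball2) : Real.cosh (hypDist z w / 2) = coshHalf z w := by
  rw [hypDist_eq, mul_div_cancel_left₀ _ two_ne_zero, Real.cosh_arcosh (one_le_coshHalf z w)]

theorem hypDist_nonneg (z w : Ball2) : 0 ≤ hypDist z w := by
  rw [hypDist_eq]
  have := Real.arcosh_nonneg (one_le_coshHalf z w)
  positivity

theorem coshHalf_smul_left (g : SU21) (z w : Ball2) :
    coshHalf (g • z) w = ‖autFactor g z.1 * polar (g • z).1 w.1‖ /
      √((1 - normSq2 z.1) * (1 - normSq2 w.1)) := by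
  have h2 := norm_pos_iff.mpr (autFactor_ne_zero g z)
  rw [coshHalf, ← one_sub_normSq2_smul g z, mul_assoc, Real.sqrt_mul (sq_nonneg _),
    Real.sqrt_sq h2.le, norm_mul, mul_div_mul_left _ _ h2.ne']

theorem coshHalf_smul_smul (g : SU21) (z w : Ball2) :
    coshHalf (g • z) (g • w) = coshHalf z w := by
  have h1 := norm_pos_iff.mpr (autFactor_ne_zero g w)
  rw [coshHalf_smul_left, coshHalf, ← polar_smul_smul g z w, ← one_sub_normSq2_smul g w,
    mul_left_comm (1 - normSq2 z.1), Real.sqrt_mul (sq_nonneg _), Real.sqrt_sq h1.le, norm_mul,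
    norm_mul, norm_mul, norm_star, mul_comm ‖autFactor g z.1‖ ‖autFactor g w.1‖, mul_assoc,
    mul_div_mul_left _ _ h1.ne']

/-- Up to a denominator at most 1, the right side is `|j(γ, 0)| |P(z, γ⁻¹0)| |P(γz, w)|`, and both
polarizations are bounded below independently of `γ`. Orbit sums are thereby dominated by a series
at the origin. -/
theorem le_coshHalf_smul (g : SU21) (z w : Ball2) :
    ‖autFactor g 0‖ * ((1 - √(normSq2 z.1)) * (1 - √(normSq2 w.1))) ≤ coshHalf (g • z) w := by
  have hz := one_sub_normSq2_pos z
  have hw := one_sub_normSq2_pos w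
  have hz1 := sub_pos.mpr (sqrt_normSq2_lt_one z)
  have hw1 := sub_pos.mpr (sqrt_normSq2_lt_one w)
  rw [coshHalf_smul_left, norm_mul, norm_autFactor_eq, norm_polar_comm (g • z).1]
  have h1 : √((1 - normSq2 z.1) * (1 - normSq2 w.1)) ≤ 1 := by
    rw [Real.sqrt_le_iff, one_pow]
    refine ⟨zero_le_one, ?_⟩
    exact mul_le_one₀ (by linarith [normSq2_nonneg z.1]) hw.le (by linarith [normSq2_nonneg w.1])
  refine le_trans ?_ (le_div_self (by positivity) (by positivity) h1)
  rw [mul_assoc]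
  gcongr
  · exact one_sub_sqrt_le_norm_polar z _
  · exact one_sub_sqrt_le_norm_polar w _

/-! ### Convergence and uniform bounds over `Γ` -/

theorem integrable_one_sub_normSq2_pow_four :
    Integrable (fun z : Ball2 => ((1 - normSq2 z.1 : ℝ) : ℂ) ^ 4) hypVol := by
  rw [integrable_hypVol_iff (fun z => ((1 - normSq2 z : ℝ) : ℂ) ^ 4)]
  have hc : Continuous fun z : Fin 2 → ℂ => ((1 - normSq2 z : ℝ) : ℂ) :=
    Complex.continuous_ofReal.comp (continuous_const.sub continuous_normSq2)
  refine (integrableOn_ballSet_of_bound hc.continuousOn 1 fun z hz => ?_).congr_fun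
    (fun z hz => ?_) measurableSet_ballSet
  · have h1 : 0 < 1 - normSq2 z := sub_pos.mpr hz
    rw [Complex.norm_real, Real.norm_of_nonneg h1.le]
    linarith [normSq2_nonneg z]
  · have h1 : (1 - normSq2 z : ℝ) ≠ 0 := (sub_pos.mpr hz).ne'
    have h2 : ((1 - normSq2 z : ℝ) : ℂ) ≠ 0 := by exact_mod_cast h1
    beta_reduce
    rw [Complex.ofReal_div, Complex.ofReal_pow, Complex.ofReal_one]
    field_simp

theorem ballWeight_pos {k : ℕ} (hk : 1 ≤ k) : 0 < ballWeight k := by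
  obtain ⟨c, hc, h⟩ := exists_le_ballWeight
  exact (by positivity : 0 < c / (k : ℝ) ^ 2).trans_le (h k hk)

/-- Ensures that a fundamental domain is not null, so that an almost-everywhere statement on it
yields a point. -/
theorem hypVol_ne_zero : hypVol ≠ 0 := by
  intro h
  have h1 := reproducing_origin (f := fun _ => 1) (differentiableOn_const 1) (le_refl 2) (M := 1)
    fun z => by
      have := one_sub_normSq2_pos z
      rw [norm_one, one_pow, one_mul]
      exact pow_le_one₀ this.le (by linarith [normSq2_nonneg z.1])
  rw [h, integral_zero_measure, one_mul] at h1
  exact (ballWeight_pos one_le_two).ne' (by exact_mod_cast h1.symm)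

section
variable {Γ : Subgroup SU21}

/-- Unfolding the finite integral of `(1 - |z|²)⁴` makes the sum of `(1 - |γz|²)⁴ = (1 - |z|²)⁴
|j(γ, z)|⁻⁸` finite at almost every `z` in `F`. One such `z` suffices, since `|j(γ, z)| ≤ 2|j(γ,
0)|`. -/
theorem summable_inv_norm_autFactor_zero [Countable Γ] {F : Set Ball2}
    (hF : IsFundamentalDomain Γ F hypVol) :
    Summable fun γ : Γ => (‖autFactor γ 0‖⁻¹) ^ 8 := by
  have hi := integrable_one_sub_normSq2_pow_four
  have h1 := hF.lintegral_eq_tsum'' fun z => ‖((1 - normSq2 z.1 : ℝ) : ℂ) ^ 4‖ₑ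
  have hm : ∀ γ : Γ, AEMeasurable (fun z => ‖((1 - normSq2 (γ • z).1 : ℝ) : ℂ) ^ 4‖ₑ)
      (hypVol.restrict F) := fun γ => (hi.1.comp_quasiMeasurePreserving
    (measurePreserving_smul γ hypVol).quasiMeasurePreserving).enorm.restrict
  rw [← lintegral_tsum hm] at h1
  have hfin : ∫⁻ z in F, ∑' γ : Γ, ‖((1 - normSq2 (γ • z).1 : ℝ) : ℂ) ^ 4‖ₑ ∂hypVol ≠ ⊤ := by
    rw [← h1]
    exact hi.2.ne
  have hae := ae_lt_top' (AEMeasurable.tsum hm) hfin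
  have hne : (ae (hypVol.restrict F)).NeBot := by
    rw [ae_neBot, Ne, Measure.restrict_eq_zero]
    exact hF.measure_ne_zero hypVol_ne_zero
  obtain ⟨z, hz⟩ := hae.exists
  have hs := ENNReal.summable_toReal hz.ne
  simp only [toReal_enorm] at hs
  have hz0 := one_sub_normSq2_pos z
  refine (hs.mul_left (2 ^ 8 / (1 - normSq2 z.1) ^ 4)).of_nonneg_of_le
    (fun γ => by positivity) fun γ => ?_
  have ha := norm_pos_iff.mpr (autFactor_ne_zero γ z)
  have ha0 := zero_lt_one.trans_le (one_le_norm_autFactor_zero (γ : SU21))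
  have hγ := one_sub_normSq2_smul γ z
  have hγ0 := one_sub_normSq2_pos ((γ : SU21) • z)
  change _ ≤ _ * ‖((1 - normSq2 ((γ : SU21) • z).1 : ℝ) : ℂ) ^ 4‖
  rw [norm_pow, Complex.norm_real, Real.norm_of_nonneg hγ0.le, ← hγ]
  have hle : ‖autFactor γ z.1‖ ≤ 2 * ‖autFactor γ 0‖ := by
    rw [norm_autFactor_eq, mul_comm 2]
    exact mul_le_mul_of_nonneg_left (norm_polar_le_two _ _) (norm_nonneg _)
  have : (2 : ℝ) ^ 8 / (‖autFactor γ z.1‖ ^ 2 * (1 - normSq2 ((γ : SU21) • z).1)) ^ 4 *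
      (1 - normSq2 ((γ : SU21) • z).1) ^ 4 = (2 / ‖autFactor γ z.1‖) ^ 8 := by
    field_simp
  rw [this]
  gcongr
  rw [inv_le_comm₀ ha0 (by positivity), inv_div, div_le_iff₀ two_pos, mul_comm]
  exact hle

/-- The images of concentric open balls form an increasing open cover of the compact quotient, so
one of them is everything. -/
theorem exists_smul_normSq2_le [CompactSpace (PicardSurface Γ)] :
    ∃ r : ℝ, r < 1 ∧ ∀ z : Ball2, ∃ γ : Γ, normSq2 (γ • z).1 ≤ r := by
  let U : ℕ → Set (PicardSurface Γ) := fun n =>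
    proj Γ '' {z : Ball2 | normSq2 z.1 < 1 - 1 / ((n : ℝ) + 1)}
  have hopen : ∀ n, IsOpen (U n) := fun n =>
    isOpenMap_quotient_mk'_mul (Γ := Γ) (T := Ball2) _
      (isOpen_lt (continuous_normSq2.comp continuous_subtype_val) continuous_const)
  have hcov : Set.univ ⊆ ⋃ n, U n := by
    intro x _
    obtain ⟨z, rfl⟩ := Quotient.exists_rep x
    obtain ⟨n, hn⟩ := exists_nat_one_div_lt (one_sub_normSq2_pos z)
    exact Set.mem_iUnion.2 ⟨n, z, by
      change normSq2 z.1 < 1 - 1 / ((n : ℝ) + 1)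
      linarith, rfl⟩
  have hmono : Monotone U := by
    intro m n hmn
    refine Set.image_mono fun z (hz : normSq2 z.1 < _) => ?_
    have := Nat.one_div_le_one_div (α := ℝ) hmn
    change normSq2 z.1 < _
    linarith
  obtain ⟨n, hn⟩ := isCompact_univ.elim_directed_cover U hopen hcov hmono.directed_le
  refine ⟨1 - 1 / ((n : ℝ) + 1), by
    have : 0 < 1 / ((n : ℝ) + 1) := Nat.one_div_pos_of_nat
    linarith, fun z => ?_⟩
  obtain ⟨w, hw, hwz⟩ := hn (Set.mem_univ (proj Γ z))
  obtain ⟨γ, hγ⟩ : w ∈ MulAction.orbit Γ z := Quotient.exact hwz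
  exact ⟨γ, by rw [show γ • z = w from hγ]; exact le_of_lt hw⟩

/-- Both points can be moved into a fixed smaller ball, where `le_coshHalf_smul` is uniform; the sum
only gets reindexed. -/
theorem exists_tsum_coshHalf_le [CompactSpace (PicardSurface Γ)]
    (hs : Summable fun γ : Γ => (‖autFactor γ 0‖⁻¹) ^ 8) :
    ∃ C : ℝ, ∀ z w : Ball2, Summable (fun γ : Γ => ((coshHalf (γ • z) w)⁻¹) ^ 8) ∧
      ∑' γ : Γ, ((coshHalf (γ • z) w)⁻¹) ^ 8 ≤ C := by
  obtain ⟨r, hr1, hr⟩ := exists_smul_normSq2_le (Γ := Γ)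
  have hr' : 0 < 1 - √r := by
    rw [sub_pos, Real.sqrt_lt' one_pos, one_pow]; exact hr1
  set A : ℝ := (((1 - √r) * (1 - √r))⁻¹) ^ 8
  have key : ∀ z w : Ball2, normSq2 z.1 ≤ r → normSq2 w.1 ≤ r → ∀ γ : Γ,
      ((coshHalf (γ • z) w)⁻¹) ^ 8 ≤ (‖autFactor γ 0‖⁻¹) ^ 8 * A := by
    intro z w hz hw γ
    rw [← mul_pow, ← mul_inv]
    have h0 := zero_lt_one.trans_le (one_le_norm_autFactor_zero (γ : SU21))
    have h1 := zero_lt_one.trans_le (one_le_coshHalf (γ • z) w)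
    gcongr
    refine le_trans ?_ (le_coshHalf_smul (γ : SU21) z w)
    have hz' := Real.sqrt_le_sqrt hz
    have hw' := Real.sqrt_le_sqrt hw
    gcongr
    exact (sub_pos.mpr (sqrt_normSq2_lt_one z)).le
  refine ⟨(∑' γ : Γ, (‖autFactor γ 0‖⁻¹) ^ 8) * A, fun z w => ?_⟩
  obtain ⟨α, hα⟩ := hr z
  obtain ⟨β, hβ⟩ := hr w
  have hsum : Summable fun γ : Γ => ((coshHalf (γ • α • z) (β • w))⁻¹) ^ 8 :=
    (hs.mul_right A).of_nonneg_of_le (fun γ => by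
      have := one_le_coshHalf (γ • α • z) (β • w)
      positivity) (key _ _ hα hβ)
  -- This is `γ ↦ βγα⁻¹`: it absorbs `α`, and then `β` acts on both arguments and drops out by
  -- isometry.
  let e : Γ ≃ Γ := (Equiv.mulLeft β).trans (Equiv.mulRight α⁻¹)
  have he : (fun γ : Γ => ((coshHalf (γ • z) w)⁻¹) ^ 8) =
      (fun γ : Γ => ((coshHalf (γ • α • z) (β • w))⁻¹) ^ 8) ∘ e := by
    funext γ
    have h1 : e γ • α • z = β • γ • z := by
      simp [e, mul_smul]
    simp only [Function.comp_apply, h1]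
    rw [show coshHalf (β • γ • z) (β • w) = _ from coshHalf_smul_smul (β : SU21) (γ • z) w]
  rw [he]
  refine ⟨(Equiv.summable_iff e).2 hsum, ?_⟩
  rw [show ∑' γ, ((fun γ : Γ => ((coshHalf (γ • α • z) (β • w))⁻¹) ^ 8) ∘ e) γ = _ from
    Equiv.tsum_eq e (fun γ : Γ => ((coshHalf (γ • α • z) (β • w))⁻¹) ^ 8), ← tsum_mul_right]
  exact hsum.tsum_le_tsum (key _ _ hα hβ) (hs.mul_right A)

/-- The left side is `Γ`-invariant and continuous, and every orbit meets a fixed compact ball. -/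
theorem exists_bound_of_automorphic [CompactSpace (PicardSurface Γ)] {f : (Fin 2 → ℂ) → ℂ}
    (hf : ContinuousOn f ballSet) {m : ℕ}
    (hinv : ∀ (γ : Γ) (z : Ball2), f (γ • z).1 = autFactor γ z.1 ^ m * f z.1) :
    ∃ M : ℝ, ∀ z : Ball2, ‖f z.1‖ ^ 2 * (1 - normSq2 z.1) ^ m ≤ M := by
  obtain ⟨r, hr1, hr⟩ := exists_smul_normSq2_le (Γ := Γ)
  set K : Set (Fin 2 → ℂ) := {z | normSq2 z ≤ r}
  have hKsub : K ⊆ ballSet := fun z hz => lt_of_le_of_lt hz hr1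
  have hK : IsCompact K := by
    refine (isCompact_closedBall (0 : Fin 2 → ℂ) 1).of_isClosed_subset
      (isClosed_le continuous_normSq2 continuous_const) fun z hz => ?_
    exact mem_closedBall_zero_iff.2 (norm_le_one_of_mem_ballSet (hKsub hz))
  obtain ⟨M, hM⟩ := hK.exists_bound_of_continuousOn
    (f := fun z => ‖f z‖ ^ 2 * (1 - normSq2 z) ^ m)
    (((hf.mono hKsub).norm.pow 2).mul
      ((continuous_const.sub continuous_normSq2).pow m).continuousOn)
  refine ⟨M, fun z => ?_⟩
  obtain ⟨γ, hγ⟩ := hr z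
  refine le_trans (le_of_eq ?_) ((le_abs_self _).trans (hM _ hγ))
  rw [hinv, ← one_sub_normSq2_smul γ z, norm_mul, norm_pow]
  change _ = _ * (1 - normSq2 ((γ : SU21) • z).1) ^ m
  rw [mul_pow, mul_pow, pow_right_comm]
  ring
end

/-! ### Poincaré series -/

/-- The derivative of `z ↦ polar z u`. -/
def polarDeriv (u : Fin 2 → ℂ) : (Fin 2 → ℂ) →L[ℂ] ℂ :=
  -(star (u 0) • ContinuousLinearMap.proj 0 + star (u 1) • ContinuousLinearMap.proj 1)

theorem polar_eq_add (u z : Fin 2 → ℂ) : polar z u = 1 + polarDeriv u z := by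
  simp [polar, polarDeriv]
  ring

theorem norm_polarDeriv_le {u : Fin 2 → ℂ} (hu : u ∈ ballSet) : ‖polarDeriv u‖ ≤ 2 := by
  refine ContinuousLinearMap.opNorm_le_bound _ two_pos.le fun z => ?_
  have h : ∀ i, ‖star (u i) * z i‖ ≤ ‖z‖ := fun i => by
    rw [norm_mul, norm_star]
    calc ‖u i‖ * ‖z i‖ ≤ 1 * ‖z‖ := by
          gcongr
          · exact (norm_le_pi_norm u i).trans (norm_le_one_of_mem_ballSet hu)
          · exact norm_le_pi_norm z i
      _ = ‖z‖ := one_mul _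
  change ‖-(star (u 0) * z 0 + star (u 1) * z 1)‖ ≤ _
  rw [norm_neg]
  linarith [norm_add_le (star (u 0) * z 0) (star (u 1) * z 1), h 0, h 1]

theorem hasFDerivAt_polar (u z : Fin 2 → ℂ) :
    HasFDerivAt (fun z => polar z u) (polarDeriv u) z := by
  simp only [polar_eq_add]
  exact (polarDeriv u).hasFDerivAt.const_add 1

/-- `z ↦ P(z, u)` is 2-Lipschitz, so moving by a quarter of the gap `1 - |z₀|` costs at most half of
it. The bound is uniform in `u`, as locally uniform convergence requires. -/
theorem le_norm_polar_of_dist {z₀ : Ball2} {z : Fin 2 → ℂ}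
    (hz : z ∈ Metric.ball z₀.1 ((1 - √(normSq2 z₀.1)) / 4)) (u : Ball2) :
    (1 - √(normSq2 z₀.1)) / 2 ≤ ‖polar z u.1‖ := by
  rw [mem_ball_iff_norm] at hz
  have h1 : polar z u.1 - polar z₀.1 u.1 = polarDeriv u.1 (z - z₀.1) := by
    rw [polar_eq_add, polar_eq_add, map_sub]
    ring
  have h2 : ‖polarDeriv u.1 (z - z₀.1)‖ ≤ 2 * ‖z - z₀.1‖ :=
    (ContinuousLinearMap.le_opNorm _ _).trans (by gcongr; exact norm_polarDeriv_le u.2)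
  have h3 := one_sub_sqrt_le_norm_polar z₀ u
  have h4 := norm_sub_norm_le (polar z₀.1 u.1) (polar z u.1)
  rw [norm_sub_rev, h1] at h4
  linarith

section
variable {Γ : Subgroup SU21}

/-- The term of the Poincaré series of weight `m` based at `w`. -/
def poincareTerm (m : ℕ) (w : Ball2) (γ : SU21) (z : Fin 2 → ℂ) : ℂ :=
  ((star (autFactor γ⁻¹ w.1) * polar z (γ⁻¹ • w).1)⁻¹) ^ m

/-- The Poincaré series of weight `m` based at `w`. -/
def poincare (Γ : Subgroup SU21) (m : ℕ) (w : Ball2) (z : Fin 2 → ℂ) : ℂ :=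
  ∑' γ : Γ, poincareTerm m w γ z

/-- The right side is the classical term. In the defining form `z` occurs in a single polarization,
so derivatives in `z` are immediate and summability over `γ` rests on a factor free of `z`. -/
theorem poincareTerm_eq (m : ℕ) (w : Ball2) (γ : SU21) (z : Ball2) :
    poincareTerm m w γ z.1 = ((autFactor γ z.1 * polar (γ • z).1 w.1)⁻¹) ^ m := by
  rw [poincareTerm, autFactor_mul_polar_smul]

theorem poincareTerm_smul (m : ℕ) (w : Ball2) (γ δ : SU21) (z : Ball2) :
    poincareTerm m w γ (δ • z).1 = autFactor δ z.1 ^ m * poincareTerm m w (γ * δ) z.1 := by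
  have h := autFactor_ne_zero δ z
  rw [poincareTerm_eq, poincareTerm_eq, autFactor_mul, mul_smul, ← mul_pow]
  congr 1
  field_simp

theorem poincare_smul (m : ℕ) (w : Ball2) (δ : Γ) (z : Ball2) :
    poincare Γ m w (δ • z).1 = autFactor δ z.1 ^ m * poincare Γ m w z.1 := by
  rw [poincare, poincare, ← tsum_mul_left,
    ← (Equiv.mulRight δ).tsum_eq fun γ : Γ => autFactor δ z.1 ^ m * poincareTerm m w γ z.1]
  exact tsum_congr fun γ => poincareTerm_smul m w γ δ z

/-- The factor `j(γ, z)` turns the weight at `z` into the weight at `γz`, leaving the invariant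
quantity `cosh(d(γz, w)/2)`. -/
theorem norm_poincareTerm (m : ℕ) (w : Ball2) (γ : SU21) (z : Ball2) :
    ‖poincareTerm m w γ z.1‖ * √((1 - normSq2 z.1) ^ m) * √((1 - normSq2 w.1) ^ m) =
      ((coshHalf (γ • z) w)⁻¹) ^ m := by
  have hz := one_sub_normSq2_pos z
  have hw := one_sub_normSq2_pos w
  rw [poincareTerm_eq, coshHalf_smul_left, norm_pow, norm_inv, inv_div, mul_assoc,
    ← Real.sqrt_mul (by positivity), ← mul_pow]
  have hsq : √(((1 - normSq2 z.1) * (1 - normSq2 w.1)) ^ m) =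
      √((1 - normSq2 z.1) * (1 - normSq2 w.1)) ^ m := by
    rw [Real.sqrt_eq_iff_eq_sq (by positivity) (by positivity), pow_right_comm,
      Real.sq_sqrt (by positivity)]
  rw [hsq, ← mul_pow, div_eq_inv_mul]

theorem summable_inv_norm_autFactor_inv
    (hs : Summable fun γ : Γ => (‖autFactor γ 0‖⁻¹) ^ 8) {m : ℕ} (hm : 8 ≤ m) (w : Ball2) :
    Summable fun γ : Γ => (‖autFactor (γ : SU21)⁻¹ w.1‖⁻¹) ^ m := by
  have hw := sub_pos.mpr (sqrt_normSq2_lt_one w)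
  refine (hs.mul_right (((1 - √(normSq2 w.1))⁻¹) ^ m)).of_nonneg_of_le
    (fun γ => by positivity) fun γ => ?_
  have h1 := one_le_norm_autFactor_zero (γ : SU21)
  have h0 := zero_lt_one.trans_le h1
  calc (‖autFactor (γ : SU21)⁻¹ w.1‖⁻¹) ^ m
      ≤ ((‖autFactor γ 0‖ * (1 - √(normSq2 w.1)))⁻¹) ^ m := by
        gcongr
        exact le_norm_autFactor_inv γ w
    _ = (‖autFactor γ 0‖⁻¹) ^ m * ((1 - √(normSq2 w.1))⁻¹) ^ m := by rw [mul_inv, mul_pow]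
    _ ≤ _ := by
        gcongr ?_ * _
        exact pow_le_pow_of_le_one (by positivity) (inv_le_one_of_one_le₀ h1) hm

theorem norm_inv_mul_pow_le {a b : ℂ} {c : ℝ} (hc : 0 < c) (hb : c ≤ ‖b‖) (m : ℕ) :
    ‖((star a * b)⁻¹) ^ m‖ ≤ (‖a‖⁻¹) ^ m * (c⁻¹) ^ m := by
  rw [norm_pow, norm_inv, norm_mul, norm_star, mul_inv, mul_pow]
  gcongr

theorem summable_poincareTerm
    (hs : Summable fun γ : Γ => (‖autFactor γ 0‖⁻¹) ^ 8) {m : ℕ} (hm : 8 ≤ m) (w z : Ball2) :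
    Summable fun γ : Γ => poincareTerm m w γ z.1 :=
  Summable.of_norm_bounded ((summable_inv_norm_autFactor_inv hs hm w).mul_right _) fun _ =>
    norm_inv_mul_pow_le (sub_pos.mpr (sqrt_normSq2_lt_one z)) (one_sub_sqrt_le_norm_polar z _) m

theorem hasFDerivAt_poincareTerm (m : ℕ) (w : Ball2) (γ : SU21) {z : Fin 2 → ℂ}
    (hz : polar z (γ⁻¹ • w).1 ≠ 0) :
    HasFDerivAt (poincareTerm m w γ)
      ((-(m * poincareTerm m w γ z * (polar z (γ⁻¹ • w).1)⁻¹)) • polarDeriv (γ⁻¹ • w).1) z := by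
  have ha : star (autFactor γ⁻¹ w.1) ≠ 0 := by
    rw [Ne, star_eq_zero]
    exact autFactor_ne_zero γ⁻¹ w
  have hne := mul_ne_zero ha hz
  have hd : HasDerivAt (fun t : ℂ => ((star (autFactor γ⁻¹ w.1) * t)⁻¹) ^ m)
      (-(m * poincareTerm m w γ z * (polar z (γ⁻¹ • w).1)⁻¹)) (polar z (γ⁻¹ • w).1) := by
    have h := ((((hasDerivAt_id (polar z (γ⁻¹ • w).1)).const_mul
      (star (autFactor γ⁻¹ w.1))).inv hne).pow m)
    refine h.congr_deriv ?_
    rcases m with _ | m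
    · simp
    · simp only [poincareTerm, id_eq, Nat.add_sub_cancel, pow_succ, mul_one]
      simp only [Pi.inv_apply, inv_pow]
      field_simp
  exact HasDerivAt.comp_hasFDerivAt
    (h₂ := fun t : ℂ => ((star (autFactor γ⁻¹ w.1) * t)⁻¹) ^ m) z hd (hasFDerivAt_polar (γ⁻¹ • w).1 z)

theorem differentiableOn_poincare
    (hs : Summable fun γ : Γ => (‖autFactor γ 0‖⁻¹) ^ 8) {m : ℕ} (hm : 8 ≤ m) (w : Ball2) :
    DifferentiableOn ℂ (poincare Γ m w) ballSet := by
  intro z hz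
  set c : ℝ := (1 - √(normSq2 z)) / 2 with hc
  have hpos : 0 < 1 - √(normSq2 z) := sub_pos.mpr (sqrt_normSq2_lt_one ⟨z, hz⟩)
  have hc0 : 0 < c := by positivity
  have hpolar : ∀ x ∈ Metric.ball z ((1 - √(normSq2 z)) / 4), ∀ u : Ball2, c ≤ ‖polar x u.1‖ :=
    fun x hx u => le_norm_polar_of_dist (z₀ := ⟨z, hz⟩) hx u
  have hmem : z ∈ Metric.ball z ((1 - √(normSq2 z)) / 4) := Metric.mem_ball_self (by positivity)
  -- Termwise differentiation on a small ball around `z`: the derivatives are dominated there by a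
  -- constant times `|j(γ⁻¹, w)|^{-m}`.
  refine (hasFDerivAt_tsum_of_isPreconnected
    ((summable_inv_norm_autFactor_inv hs hm w).mul_left (m * (c⁻¹) ^ m * c⁻¹ * 2))
    Metric.isOpen_ball (convex_ball z ((1 - √(normSq2 z)) / 4)).isPreconnected
    (fun (γ : Γ) x hx => hasFDerivAt_poincareTerm m w γ
      (norm_pos_iff.mp (hc0.trans_le (hpolar x hx _)))) (fun γ x hx => ?_) hmem
    (summable_poincareTerm hs hm w ⟨z, hz⟩) hmem).differentiableAt.differentiableWithinAt
  rw [norm_smul, norm_neg, norm_mul, norm_mul, Complex.norm_natCast, norm_inv]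
  have h1 := hpolar x hx ((γ : SU21)⁻¹ • w)
  calc _ ≤ m * ((‖autFactor (γ : SU21)⁻¹ w.1‖⁻¹) ^ m * (c⁻¹) ^ m) * c⁻¹ * 2 := by
        gcongr
        · exact norm_inv_mul_pow_le hc0 h1 m
        · exact norm_polarDeriv_le ((γ : SU21)⁻¹ • w).2
    _ = _ := by ring

/-- Unfolding: the Petersson product with a Poincaré series evaluates an automorphic form. -/
theorem integral_mul_star_poincare [Countable Γ] {F : Set Ball2}
    (hF : IsFundamentalDomain Γ F hypVol) {k : ℕ} (hk : 2 ≤ k) {f : (Fin 2 → ℂ) → ℂ}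
    (hf : DifferentiableOn ℂ f ballSet) {M : ℝ}
    (hb : ∀ z : Ball2, ‖f z.1‖ ^ 2 * (1 - normSq2 z.1) ^ (3 * k) ≤ M)
    (hinv : ∀ (γ : Γ) (z : Ball2), f (γ • z).1 = autFactor γ z.1 ^ (3 * k) * f z.1) (w : Ball2) :
    ∫ z in F, f z.1 * star (poincare Γ (3 * k) w z.1) *
      ((1 - normSq2 z.1 : ℝ) : ℂ) ^ (3 * k) ∂hypVol = f w.1 * ballWeight k := by
  set h : (Fin 2 → ℂ) → ℂ := fun z => f z * ((polar w.1 z)⁻¹) ^ (3 * k) *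
    ((1 - normSq2 z : ℝ) : ℂ) ^ (3 * k) with hh
  have hM : 0 ≤ M := (hb w).trans' (by have := one_sub_normSq2_pos w; positivity)
  have hw := sub_pos.mpr (sqrt_normSq2_lt_one w)
  have hpc : Continuous fun z : Fin 2 → ℂ => polar w.1 z := by unfold polar; fun_prop
  have hnc : Continuous fun z : Fin 2 → ℂ => ((1 - normSq2 z : ℝ) : ℂ) :=
    Complex.continuous_ofReal.comp (continuous_const.sub continuous_normSq2)
  have hint : Integrable (fun z : Ball2 => h z.1) hypVol := by
    rw [integrable_hypVol_iff h]
    refine (integrableOn_ballSet_of_bound (h := fun z => f z * ((polar w.1 z)⁻¹) ^ (3 * k) *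
      ((1 - normSq2 z : ℝ) : ℂ) ^ (3 * k - 3)) ((hf.continuousOn.mul ((hpc.continuousOn.inv₀
      fun z hz => polar_ne_zero w ⟨z, hz⟩).pow _)).mul (hnc.pow _).continuousOn)
      (√M * ((1 - √(normSq2 w.1))⁻¹) ^ (3 * k)) fun z hz => ?_).congr_fun (fun z hz => ?_)
      measurableSet_ballSet
    · have h1 : 0 < 1 - normSq2 z := sub_pos.mpr hz
      rw [norm_mul, norm_mul, norm_pow, norm_pow, norm_inv, Complex.norm_real,
        Real.norm_of_nonneg h1.le, mul_right_comm]
      gcongr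
      · refine Real.le_sqrt_of_sq_le (le_trans ?_ (hb ⟨z, hz⟩))
        rw [mul_pow, ← pow_mul]
        gcongr ?_ * ?_
        exact pow_le_pow_of_le_one h1.le (by linarith [normSq2_nonneg z]) (by omega)
      · exact one_sub_sqrt_le_norm_polar w ⟨z, hz⟩
    · have h1 : (1 - normSq2 z : ℝ) ≠ 0 := (sub_pos.mpr hz).ne'
      have h2 : ((1 - normSq2 z : ℝ) : ℂ) ≠ 0 := by exact_mod_cast h1
      have h3 : ((1 - normSq2 z : ℝ) : ℂ) ^ (3 * k) = ((1 - normSq2 z : ℝ) : ℂ) ^ (3 * k - 3) *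
          ((1 - normSq2 z : ℝ) : ℂ) ^ 3 := by rw [← pow_add]; congr 1; omega
      rw [hh]
      beta_reduce
      rw [h3, Complex.ofReal_div, Complex.ofReal_pow, Complex.ofReal_one]
      field_simp
  -- The factors `j^{3k}` from `f` and from the kernel, and `|j|^{-6k}` from the weight, combine so
  -- that each translate of the integrand is `f` times the conjugate of one Poincaré term.
  have hterm : ∀ (γ : Γ) (z : Ball2), h (γ • z).1 = f z.1 * star (poincareTerm (3 * k) w γ z.1) *
      ((1 - normSq2 z.1 : ℝ) : ℂ) ^ (3 * k) := by
    intro γ z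
    have h1 := autFactor_ne_zero (γ : SU21) z
    have h1' : star (autFactor (γ : SU21) z.1) ≠ 0 := star_ne_zero.2 h1
    have h2 := polar_smul_smul (γ : SU21) z z
    have h3 := polar_ne_zero w (γ • z)
    rw [hh]
    beta_reduce
    rw [hinv, ← polar_self, ← polar_self, poincareTerm_eq, ← h2, star_pow, star_inv₀, star_mul',
      star_polar]
    change _ * ((polar w.1 ((γ : SU21) • z).1)⁻¹) ^ (3 * k) *
      polar ((γ : SU21) • z).1 ((γ : SU21) • z).1 ^ (3 * k) = _
    simp only [mul_pow, mul_inv, inv_pow]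
    field_simp
  have hmeas : ∀ γ : Γ, AEStronglyMeasurable (fun z : Ball2 => h (γ • z).1)
      (hypVol.restrict F) := fun γ => (hint.1.comp_quasiMeasurePreserving
    (measurePreserving_smul γ hypVol).quasiMeasurePreserving).restrict
  have hrep := reproducing hf hk hb w
  rw [← hrep, show ∫ z : Ball2, f z.1 * ((polar w.1 z.1)⁻¹) ^ (3 * k) *
    ((1 - normSq2 z.1 : ℝ) : ℂ) ^ (3 * k) ∂hypVol = _ from
    hF.integral_eq_tsum'' (fun z : Ball2 => h z.1) hint, ← integral_tsum hmeas]
  · refine integral_congr_ae (Filter.Eventually.of_forall fun z => ?_)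
    beta_reduce
    simp only [hterm]
    rw [tsum_mul_right, tsum_mul_left, poincare, tsum_star]
  · rw [← hF.lintegral_eq_tsum'' fun z : Ball2 => ‖h z.1‖ₑ]
    exact hint.2.ne
end

/-! ### The Bergman kernel as a Poincaré series -/

section
variable {Γ : Subgroup SU21}

theorem coeffDz_smul_dzFrame (k : ℕ) (a : ℂ) : coeffDz k (a • dzFrame k) = a := by
  rw [map_smul, coeffDz_dzFrame, smul_eq_mul, mul_one]

theorem fibreInner_smul_dzFrame (k : ℕ) (z : Ball2) (a b : ℂ) :
    fibreInner k z (a • dzFrame k) (b • dzFrame k) =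
      a * star b * ((1 - normSq2 z.1 : ℝ) : ℂ) ^ (3 * k) := by
  rw [fibreInner, coeffDz_smul_dzFrame, coeffDz_smul_dzFrame, frameNormSq_eq, Complex.ofReal_pow]

/-- The Poincaré series as a section of the pluricanonical bundle. -/
def poincareSection (Γ : Subgroup SU21) {k : ℕ} (w : Ball2)
    (hs : Summable fun γ : Γ => (‖autFactor γ 0‖⁻¹) ^ 8) (hk : 3 ≤ k) : H0 Γ k :=
  ⟨fun z => poincare Γ (3 * k) w z.1 • dzFrame k, mem_H0_iff.2
    -- The condition `3 ≤ k` enters here: it gives a weight `3k ≥ 8`, for which the series is known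
    -- to converge.
    ⟨_, differentiableOn_poincare hs (by omega) w, fun _ => rfl, poincare_smul (3 * k) w⟩⟩

theorem l2Inner_poincareSection [Countable Γ] [CompactSpace (PicardSurface Γ)] {F : Set Ball2}
    (hF : IsFundamentalDomain Γ F hypVol) {k : ℕ} (hk : 3 ≤ k)
    (hs : Summable fun γ : Γ => (‖autFactor γ 0‖⁻¹) ^ 8) (w : Ball2) (η : H0 Γ k) :
    l2Inner F k η.1 (poincareSection Γ w hs hk).1 = coeffDz k (η.1 w) * ballWeight k := by
  obtain ⟨f, hf, hη, hinv⟩ := mem_H0_iff.1 η.2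
  obtain ⟨M, hM⟩ := exists_bound_of_automorphic hf.continuousOn hinv
  rw [hη, coeffDz_smul_dzFrame, ← integral_mul_star_poincare hF (by omega) hf hM hinv w, l2Inner]
  refine integral_congr_ae (Filter.Eventually.of_forall fun z => ?_)
  beta_reduce
  rw [hη, ← fibreInner_smul_dzFrame]
  rfl

theorem continuous_coeffDz_of_mem_H0 {k : ℕ} {ω : Ball2 → PluriFibre k} (h : ω ∈ H0 Γ k) :
    Continuous fun z => coeffDz k (ω z) := by
  obtain ⟨f, hf, hω, -⟩ := mem_H0_iff.1 h
  simp only [hω, coeffDz_smul_dzFrame]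
  exact continuousOn_iff_continuous_domRestrict.1 hf.continuousOn

theorem continuous_frameNormSq (k : ℕ) : Continuous (frameNormSq k) := by
  simp only [funext (frameNormSq_eq k)]
  exact (continuous_const.sub (continuous_normSq2.comp continuous_subtype_val)).pow _

theorem frameNormSq_nonneg (k : ℕ) (z : Ball2) : 0 ≤ frameNormSq k z := by
  rw [frameNormSq_eq]
  exact pow_nonneg (one_sub_normSq2_pos z).le _

theorem integrable_fibreInner {k : ℕ} {μ : Measure Ball2} {ω η : Ball2 → PluriFibre k}
    (hω : ω ∈ H0 Γ k) (hη : η ∈ H0 Γ k)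
    (h1 : Integrable (fun z => fibreInner k z (ω z) (ω z)) μ)
    (h2 : Integrable (fun z => fibreInner k z (η z) (η z)) μ) :
    Integrable (fun z => fibreInner k z (ω z) (η z)) μ := by
  have hc : Continuous fun z => fibreInner k z (ω z) (η z) :=
    ((continuous_coeffDz_of_mem_H0 hω).mul (continuous_coeffDz_of_mem_H0 hη).star).mul
      (Complex.continuous_ofReal.comp (continuous_frameNormSq k))
  refine (h1.norm.add h2.norm).mono' hc.aestronglyMeasurable
    (Filter.Eventually.of_forall fun z => ?_)
  simp only [Pi.add_apply, fibreInner, norm_mul, norm_star, Complex.norm_real,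
    Real.norm_of_nonneg (frameNormSq_nonneg k z)]
  rw [← add_mul]
  gcongr
  · exact frameNormSq_nonneg k z
  · nlinarith [sq_nonneg (‖coeffDz k (ω z)‖ - ‖coeffDz k (η z)‖),
      sq_nonneg ‖coeffDz k (ω z)‖, sq_nonneg ‖coeffDz k (η z)‖]

/-- The integral of a non-integrable function is 0 by convention, so `‖b i‖² = 1` forces
integrability, with no regularity needed on `F`. The mixed products follow by domination. -/
theorem integrable_fibreInner_of_orthonormal {F : Set Ball2} {k d : ℕ}
    {b : Module.Basis (Fin d) ℂ (H0 Γ k)} (hb : IsL2Orthonormal F b) (i j : Fin d) :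
    Integrable (fun z => fibreInner k z ((b i).1 z) ((b j).1 z)) (hypVol.restrict F) := by
  have hself : ∀ i, Integrable (fun z => fibreInner k z ((b i).1 z) ((b i).1 z))
      (hypVol.restrict F) := fun i => by
    by_contra hn
    have h := hb i i
    rw [l2Inner, integral_undef hn, if_pos rfl] at h
    exact zero_ne_one h
  exact integrable_fibreInner (b i).2 (b j).2 (hself i) (hself j)

theorem coeffDz_eq_sum_repr {k d : ℕ} (b : Module.Basis (Fin d) ℂ (H0 Γ k)) (η : H0 Γ k)
    (z : Ball2) : coeffDz k (η.1 z) = ∑ j, b.repr η j * coeffDz k ((b j).1 z) := by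
  let L : H0 Γ k →ₗ[ℂ] ℂ := coeffDz k ∘ₗ LinearMap.proj z ∘ₗ (H0 Γ k).subtype
  have h := congrArg L (b.sum_repr η)
  simp only [map_sum, map_smul] at h
  exact h.symm

theorem l2Inner_eq_star_repr {F : Set Ball2} {k d : ℕ}
    {b : Module.Basis (Fin d) ℂ (H0 Γ k)} (hb : IsL2Orthonormal F b) (i : Fin d) (η : H0 Γ k) :
    l2Inner F k (b i).1 η.1 = star (b.repr η i) := by
  have h : ∀ z, fibreInner k z ((b i).1 z) (η.1 z) =
      ∑ j, star (b.repr η j) * fibreInner k z ((b i).1 z) ((b j).1 z) := by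
    intro z
    simp only [fibreInner]
    rw [coeffDz_eq_sum_repr b η z, star_sum, Finset.mul_sum, Finset.sum_mul]
    refine Finset.sum_congr rfl fun j _ => ?_
    rw [star_mul']
    ring
  rw [l2Inner, integral_congr_ae (Filter.Eventually.of_forall h), integral_finsetSum _
    fun j _ => (integrable_fibreInner_of_orthonormal hb i j).const_mul _]
  simp only [integral_const_mul]
  have h2 : ∀ j, ∫ z in F, fibreInner k z ((b i).1 z) ((b j).1 z) ∂hypVol =
    if i = j then 1 else 0 := hb i
  simp [h2]

/-- The Bergman kernel is a normalized Poincaré series. -/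
theorem ballWeight_mul_bergmanKernel [Countable Γ] [CompactSpace (PicardSurface Γ)]
    {F : Set Ball2} (hF : IsFundamentalDomain Γ F hypVol) {k d : ℕ} (hk : 3 ≤ k)
    (hs : Summable fun γ : Γ => (‖autFactor γ 0‖⁻¹) ^ 8)
    {b : Module.Basis (Fin d) ℂ (H0 Γ k)} (hb : IsL2Orthonormal F b) (z w : Ball2) :
    ballWeight k * bergmanKernel b z w = poincare Γ (3 * k) w z.1 := by
  have h := coeffDz_eq_sum_repr b (poincareSection Γ w hs hk) z
  rw [show (poincareSection Γ w hs hk).1 z = poincare Γ (3 * k) w z.1 • dzFrame k from rfl,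
    coeffDz_smul_dzFrame] at h
  rw [h, bergmanKernel, Finset.mul_sum]
  refine Finset.sum_congr rfl fun j _ => ?_
  -- The coefficient along `b j` is the conjugate of its product with the Poincaré series, which is
  -- evaluation at `w`.
  have h1 : b.repr (poincareSection Γ w hs hk) j =
      star (coeffDz k ((b j).1 w)) * ballWeight k := by
    rw [← star_star (b.repr _ j), ← l2Inner_eq_star_repr hb, l2Inner_poincareSection hF hk hs,
      star_mul', Complex.star_def, Complex.conj_ofReal]
  rw [h1]
  ring

/-! ### The off-diagonal estimate -/

theorem surfDist_nonneg (x y : PicardSurface Γ) : 0 ≤ surfDist Γ x y :=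
  Real.sInf_nonneg (by rintro _ ⟨z, w, -, -, rfl⟩; exact hypDist_nonneg z w)

theorem surfDist_le_hypDist_smul (γ : Γ) (z w : Ball2) :
    surfDist Γ (proj Γ z) (proj Γ w) ≤ hypDist (γ • z) w :=
  csInf_le ⟨0, by rintro _ ⟨z, w, -, -, rfl⟩; exact hypDist_nonneg z w⟩
    ⟨γ • z, w, Quotient.sound ⟨γ, rfl⟩, rfl, rfl⟩

theorem cosh_surfDist_le_coshHalf (γ : Γ) (z w : Ball2) :
    Real.cosh (surfDist Γ (proj Γ z) (proj Γ w) / 2) ≤ coshHalf (γ • z) w := by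
  have h0 := surfDist_nonneg (proj Γ z) (proj Γ w)
  have h1 := surfDist_le_hypDist_smul γ z w
  rw [← cosh_hypDist, Real.cosh_le_cosh, abs_of_nonneg (by positivity),
    abs_of_nonneg (by linarith)]
  linarith

/-- The exponent is split as `(m - 8) + 8`: the first part is bounded uniformly in `γ` by the
distance on `X_Γ`, the second is kept for convergence. -/
theorem norm_poincare_mul_le {m : ℕ} (hm : 8 ≤ m) (z w : Ball2)
    (hs : Summable fun γ : Γ => ((coshHalf (γ • z) w)⁻¹) ^ 8) :
    ‖poincare Γ m w z.1‖ * √((1 - normSq2 z.1) ^ m) * √((1 - normSq2 w.1) ^ m) ≤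
      ((Real.cosh (surfDist Γ (proj Γ z) (proj Γ w) / 2))⁻¹) ^ (m - 8) *
        ∑' γ : Γ, ((coshHalf (γ • z) w)⁻¹) ^ 8 := by
  set A := √((1 - normSq2 z.1) ^ m) with hA
  set B := √((1 - normSq2 w.1) ^ m) with hB
  set S := Real.cosh (surfDist Γ (proj Γ z) (proj Γ w) / 2)
  have hS : 0 < S := Real.cosh_pos _
  have hz := one_sub_normSq2_pos z
  have hw := one_sub_normSq2_pos w
  have hbound : ∀ γ : Γ, ‖poincareTerm m w γ z.1‖ * A * B ≤
      (S⁻¹) ^ (m - 8) * ((coshHalf (γ • z) w)⁻¹) ^ 8 := by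
    intro γ
    have h1 := zero_lt_one.trans_le (one_le_coshHalf (γ • z) w)
    calc ‖poincareTerm m w γ z.1‖ * A * B = ((coshHalf (γ • z) w)⁻¹) ^ m :=
          norm_poincareTerm m w γ z
      _ = ((coshHalf (γ • z) w)⁻¹) ^ (m - 8) * ((coshHalf (γ • z) w)⁻¹) ^ 8 := by
          rw [← pow_add, Nat.sub_add_cancel hm]
      _ ≤ _ := by
          gcongr
          exact cosh_surfDist_le_coshHalf γ z w
  have hsum := hs.mul_left ((S⁻¹) ^ (m - 8))
  have hsum' : Summable fun γ : Γ => ‖poincareTerm m w γ z.1‖ * A * B :=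
    hsum.of_nonneg_of_le (fun γ => by positivity) hbound
  have hAB : 0 < A * B := by positivity
  have hsn : Summable fun γ : Γ => ‖poincareTerm m w γ z.1‖ := by
    simp only [mul_assoc] at hsum'
    exact (summable_mul_right_iff hAB.ne').1 hsum'
  calc ‖poincare Γ m w z.1‖ * A * B
      ≤ (∑' γ : Γ, ‖poincareTerm m w γ z.1‖) * A * B := by
        gcongr
        exact norm_tsum_le_tsum_norm hsn
    _ = ∑' γ : Γ, ‖poincareTerm m w γ z.1‖ * A * B := by rw [tsum_mul_right, tsum_mul_right]
    _ ≤ ∑' γ : Γ, (S⁻¹) ^ (m - 8) * ((coshHalf (γ • z) w)⁻¹) ^ 8 :=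
        hsum'.tsum_le_tsum hbound hsum
    _ = _ := tsum_mul_left
end

end

theorem theorem1 (Γ : Subgroup SU21)
    (hdiscrete : DiscreteTopology Γ)
    (htorsionfree : ∀ γ : Γ, γ ≠ 1 → ¬ IsOfFinOrder γ)
    (hcompact : CompactSpace (PicardSurface Γ)) :
    ∃ C : ℝ, ∀ F : Set Ball2, MeasureTheory.IsFundamentalDomain Γ F hypVol →
      ∀ k : ℕ, 3 ≤ k →
        ∀ (d : ℕ) (b : Module.Basis (Fin d) ℂ (H0 Γ k)), IsL2Orthonormal F b →
          ∀ z w : Ball2,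
            bergmanNorm b z w ≤
              C * ((k : ℝ) ^ 2 /
                Real.cosh (surfDist Γ (proj Γ z) (proj Γ w) / 2) ^ (3 * k - 8)) := by
  have := countable_of_discreteTopology Γ
  -- The constant must precede `F`. A single domain `F₀` serves to prove convergence, which does not
  -- involve the domain; if there is none, the claim is vacuous.
  by_cases hex : ∃ F : Set Ball2, MeasureTheory.IsFundamentalDomain Γ F hypVol
  swap
  · exact ⟨0, fun F hF => absurd ⟨F, hF⟩ hex⟩
  obtain ⟨F₀, hF₀⟩ := hex
  have hs := summable_inv_norm_autFactor_zero hF₀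
  obtain ⟨A, hA⟩ := exists_tsum_coshHalf_le hs
  obtain ⟨c, hc0, hc⟩ := exists_le_ballWeight
  -- `A` bounds the sum of `cosh⁻⁸`, and `c / k²` bounds `ballWeight k` from below.
  refine ⟨A / c, fun F hF k hk d b hb z w => ?_⟩
  have hk0 : (0 : ℝ) < k := by exact_mod_cast (by omega : 0 < k)
  have hW := ballWeight_pos (by omega : 1 ≤ k)
  have hcW := hc k (by omega)
  have hP := norm_poincare_mul_le (by omega : 8 ≤ 3 * k) z w (hA z w).1
  have hcosh : 0 < Real.cosh (surfDist Γ (proj Γ z) (proj Γ w) / 2) := Real.cosh_pos _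
  set S := Real.cosh (surfDist Γ (proj Γ z) (proj Γ w) / 2)
  rw [← ballWeight_mul_bergmanKernel hF hk hs hb z w, norm_mul, Complex.norm_real,
    Real.norm_of_nonneg hW.le, ← frameNormSq_eq, ← frameNormSq_eq, mul_assoc, mul_assoc] at hP
  change ballWeight k * bergmanNorm b z w ≤ _ at hP
  have hn : 0 ≤ bergmanNorm b z w := by unfold bergmanNorm; positivity
  have h1 : c / (k : ℝ) ^ 2 * bergmanNorm b z w ≤ (S⁻¹) ^ (3 * k - 8) * A :=
    (mul_le_mul_of_nonneg_right hcW hn).trans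
      (hP.trans (mul_le_mul_of_nonneg_left (hA z w).2 (by positivity)))
  rw [inv_pow] at h1
  calc bergmanNorm b z w = k ^ 2 / c * (c / (k : ℝ) ^ 2 * bergmanNorm b z w) := by field_simp
    _ ≤ k ^ 2 / c * ((S ^ (3 * k - 8))⁻¹ * A) := by gcongr
    _ = _ := by field_simp
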